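/- Let $L_k(y)=\sum_{i=0}^{k}(-1)^i\binom{k}{i}\frac{y^i}{i!}$ be the Laguerre polynomial of degree $k\in\{0,1,2,\dots\}$ and $\ell_k(y)=e^{-y/2}L_k(y)$, and write $\mathbb{R}_+=(0,+\infty)$. Let $G=\{(u,v): u\in\mathbb{R},\ v>0\}$ be equipped with the measure $d\nu=v^{-2}\,du\,dv$, let $\mathcal F$ be the unitary Fourier transform on $L_2(\mathbb{R})$, $\mathcal F g(\xi)=\int_{\mathbb R} g(x)e^{-2\pi i x\xi}\,dx$, and let $\psi^{(k)}\in L_2(\mathbb{R})$ be the function with $\mathcal F\psi^{(k)}(\xi)=\chi_{(0,+\infty)}(\xi)\sqrt{2\xi}\,\ell_k(2\xi)$. Put $\psi^{(k)}_v(x)=v^{-1/2}\psi^{(k)}(x/v)$, let $H_2^+(\mathbb{R})=\{f\in L_2(\mathbb{R}):\operatorname{supp}\mathcal F f\subseteq[0,+\infty)\}$, and let $$A^{(k)}=\bigl\{(u,v)\mapsto (f*\psi^{(k)}_v)(u) : f\in H_2^+(\mathbb{R})\bigr\}\subset L_2(G,d\nu),$$ which is a closed subspace; let $P^{(k)}$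 be the orthogonal projection of $L_2(G,d\nu)$ onto $A^{(k)}$. For $a\in L_\infty(\mathbb{R}_+)$ let $T_a^{(k)}:A^{(k)}\to A^{(k)}$, $T_a^{(k)}F=P^{(k)}(aF)$, be the Calderón–Toeplitz operator with symbol $(u,v)\mapsto a(v)$, and let $$\gamma_{a,k}(\xi)=\int_0^{\infty}a\!\left(\frac{v}{2\xi}\right)\ell_k(v)^2\,dv,\qquad \xi>0 .$$ Let $L_\infty^{\{0,+\infty\}}(\mathbb{R}_+)$ be the set of all (complex-valued) $a\in L_\infty(\mathbb{R}_+)$ that have finite limits at $0$ and at $+\infty$ (for some representative of $a$), and let $\mathcal T_k\bigl(L_\infty^{\{0,+\infty\}}(\mathbb{R}_+)\bigr)$ be the $C^*$-algebra of bounded operators on $A^{(k)}$ generated by all $T_a^{(k)}$ with $a\in L_\infty^{\{0,+\infty\}}(\mathbb{R}_+)$. Then for every $k\in\{0,1,2,\dots\}$ there is an isometric $*$-isomorphism $$\tau_k:\mathcal T_k\bigl(L_\infty^{\{0,+\infty\}}(\mathbb{R}_+)\bigr)\longrightarrow C[0,+\infty]$$ onto the algebra of continuous complex-valued functions on the two-point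 compactification $[0,+\infty]$ of $\mathbb{R}_+$ (with the supremum norm), such that for every $a\in L_\infty^{\{0,+\infty\}}(\mathbb{R}_+)$ the function $\tau_k(T_a^{(k)})$ is the continuous extension of $\gamma_{a,k}$ to $[0,+\infty]$, i.e. $\tau_k(T_a^{(k)})(\xi)=\gamma_{a,k}(\xi)$ for all $\xi>0$; and $\tau_k$ is the only isometric $*$-isomorphism with this property. -/

import Mathlib

open MeasureTheory Set Filter Topology
open scoped ENNReal FourierTransform Convolution

noncomputable section

namespace CalderonToeplitz

/-! ### Laguerre functions and the wavelets -/

/-- The Laguerre polynomial `L_k(y) = ∑_{i ≤ k} (-1)^i (k choose i) y^i / i!`. -/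
def laguerre (k : ℕ) (y : ℝ) : ℝ :=
  ∑ i ∈ Finset.range (k + 1), (-1) ^ i * (k.choose i : ℝ) * (y ^ i / (i.factorial : ℝ))

/-- The Laguerre function `ℓ_k(y) = e^{-y/2} L_k(y)`. -/
def laguerreFun (k : ℕ) (y : ℝ) : ℝ := Real.exp (-y / 2) * laguerre k y

/-- The Fourier transform `χ_+(ξ) √(2ξ) ℓ_k(2ξ)` of the wavelet of order `k`. -/
def waveletHat (k : ℕ) : ℝ → ℂ :=
  (Ioi 0).indicator fun ξ => ((√(2 * ξ) * laguerreFun k (2 * ξ) : ℝ) : ℂ)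

theorem abs_laguerre_le (k : ℕ) {y : ℝ} (hy : 0 ≤ y) :
    |laguerre k y| ≤ 9 ^ k * Real.exp (y / 8) := by
  have h9 : (9 : ℝ) ^ k = ∑ i ∈ Finset.range (k + 1), 8 ^ i * (k.choose i : ℝ) := by
    have := add_pow (8 : ℝ) 1 k
    norm_num at this
    exact this
  unfold laguerre
  refine (Finset.abs_sum_le_sum_abs _ _).trans ?_
  rw [h9, Finset.sum_mul]
  refine Finset.sum_le_sum fun i _ => ?_
  have h1 := Real.pow_div_factorial_le_exp (y / 8) (by positivity) i
  have h2 : y ^ i / (i.factorial : ℝ) = 8 ^ i * ((y / 8) ^ i / (i.factorial : ℝ)) := by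
    rw [div_pow]; field_simp
  rw [abs_mul, abs_mul, abs_pow, abs_neg, abs_one, one_pow, one_mul, Nat.abs_cast,
    abs_of_nonneg (by positivity), h2]
  calc (k.choose i : ℝ) * (8 ^ i * ((y / 8) ^ i / (i.factorial : ℝ)))
      ≤ (k.choose i : ℝ) * (8 ^ i * Real.exp (y / 8)) := by gcongr
    _ = _ := by ring

theorem abs_laguerreFun_le (k : ℕ) {y : ℝ} (hy : 0 ≤ y) :
    |laguerreFun k y| ≤ 9 ^ k * Real.exp (-(3 / 8) * y) := by
  unfold laguerreFun
  rw [abs_mul, Real.abs_exp]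
  calc Real.exp (-y / 2) * |laguerre k y|
      ≤ Real.exp (-y / 2) * (9 ^ k * Real.exp (y / 8)) := by
        gcongr; exact abs_laguerre_le k hy
    _ = 9 ^ k * (Real.exp (-y / 2) * Real.exp (y / 8)) := by ring
    _ = _ := by rw [← Real.exp_add]; ring_nf

theorem continuous_laguerreFun (k : ℕ) : Continuous (laguerreFun k) := by
  unfold laguerreFun laguerre
  fun_prop

theorem measurable_waveletHat (k : ℕ) : Measurable (waveletHat k) := by
  have := continuous_laguerreFun k
  refine Measurable.indicator ?_ measurableSet_Ioi
  exact Continuous.measurable (by fun_prop)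

theorem norm_waveletHat_le (k : ℕ) (ξ : ℝ) :
    ‖waveletHat k ξ‖ ≤ (Ioi (0 : ℝ)).indicator (fun ξ => 3 * 9 ^ k * Real.exp (-(5 / 8) * ξ)) ξ := by
  by_cases h : ξ ∈ Ioi (0 : ℝ)
  · have h0 : 0 < ξ := h
    simp only [waveletHat, indicator_of_mem h, Complex.norm_real, Real.norm_eq_abs, abs_mul]
    have hs : |√(2 * ξ)| ≤ 3 * Real.exp (ξ / 8) := by
      rw [abs_of_nonneg (Real.sqrt_nonneg _)]
      refine Real.sqrt_le_iff.2 ⟨by positivity, ?_⟩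
      rw [mul_pow, ← Real.exp_nat_mul]
      have := Real.add_one_le_exp (((2 : ℕ) : ℝ) * (ξ / 8))
      norm_num at this ⊢
      linarith
    have hl := abs_laguerreFun_le k (y := 2 * ξ) (by positivity)
    calc |√(2 * ξ)| * |laguerreFun k (2 * ξ)|
        ≤ (3 * Real.exp (ξ / 8)) * (9 ^ k * Real.exp (-(3 / 8) * (2 * ξ))) := by gcongr
      _ = 3 * 9 ^ k * (Real.exp (ξ / 8) * Real.exp (-(3 / 8) * (2 * ξ))) := by ring
      _ = _ := by rw [← Real.exp_add]; ring_nf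
  · simp [waveletHat, indicator_of_notMem h]

theorem norm_waveletHat_le_const (k : ℕ) (ξ : ℝ) : ‖waveletHat k ξ‖ ≤ 3 * 9 ^ k := by
  refine (norm_waveletHat_le k ξ).trans ?_
  by_cases h : ξ ∈ Ioi (0 : ℝ)
  · have h0 : 0 < ξ := h
    rw [indicator_of_mem h]
    have : Real.exp (-(5 / 8) * ξ) ≤ 1 := Real.exp_le_one_iff.2 (by linarith)
    exact mul_le_of_le_one_right (by positivity) this
  · rw [indicator_of_notMem h]; positivity

theorem integrable_waveletHat (k : ℕ) : Integrable (waveletHat k) := by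
  refine Integrable.mono' (g := (Ioi (0 : ℝ)).indicator
    (fun ξ => 3 * 9 ^ k * Real.exp (-(5 / 8) * ξ))) ?_
    (measurable_waveletHat k).aestronglyMeasurable (.of_forall (norm_waveletHat_le k))
  rw [integrable_indicator_iff measurableSet_Ioi]
  exact (exp_neg_integrableOn_Ioi 0 (by norm_num)).const_mul _

theorem memLp_waveletHat (k : ℕ) : MemLp (waveletHat k) 2 := by
  rw [memLp_two_iff_integrable_sq_norm (measurable_waveletHat k).aestronglyMeasurable]
  simp only [pow_two]
  refine (integrable_waveletHat k).norm.bdd_mul (c := 3 * 9 ^ k)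
    (measurable_waveletHat k).norm.aestronglyMeasurable (.of_forall fun ξ => ?_)
  simpa using norm_waveletHat_le_const k ξ

/-- The wavelet `ψ^{(k)} ∈ L₂(ℝ)`: the inverse (unitary) Fourier transform of `waveletHat k`. -/
def wavelet (k : ℕ) : Lp ℂ 2 (volume : Measure ℝ) :=
  𝓕⁻ ((memLp_waveletHat k).toLp (waveletHat k))

/-- The Hardy space `H₂⁺(ℝ)` of all `f ∈ L₂(ℝ)` with `supp 𝓕 f ⊆ [0, +∞)`. -/
def hardySpace : Submodule ℂ (Lp ℂ 2 (volume : Measure ℝ)) where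
  carrier := {f | ∀ᵐ ξ : ℝ, ξ < 0 → (𝓕 f : Lp ℂ 2 (volume : Measure ℝ)) ξ = 0}
  zero_mem' := by
    have h0 : (𝓕 (0 : Lp ℂ 2 (volume : Measure ℝ)) : Lp ℂ 2 (volume : Measure ℝ)) = 0 :=
      (Lp.fourierTransformₗᵢ ℝ ℂ).map_zero
    simp only [mem_ofPred_eq, h0]
    filter_upwards [Lp.coeFn_zero ℂ 2 (volume : Measure ℝ)] with ξ h _
    exact h
  add_mem' := by
    intro f g hf hg
    simp only [mem_ofPred_eq, FourierAdd.fourier_add]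
    filter_upwards [hf, hg, Lp.coeFn_add (𝓕 f : Lp ℂ 2 (volume : Measure ℝ)) (𝓕 g)]
      with ξ h1 h2 h3 hξ
    rw [h3, Pi.add_apply, h1 hξ, h2 hξ, add_zero]
  smul_mem' := by
    intro c f hf
    simp only [mem_ofPred_eq, FourierSMul.fourier_smul]
    filter_upwards [hf, Lp.coeFn_smul c (𝓕 f : Lp ℂ 2 (volume : Measure ℝ))] with ξ h1 h2 hξ
    rw [h2, Pi.smul_apply, h1 hξ, smul_zero]

/-! ### The affine group and the wavelet subspaces -/

/-- The measure `v⁻² dv` on the half-line `(0, +∞)`. -/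
def scaleMeasure : Measure ℝ :=
  (volume.restrict (Ioi 0)).withDensity fun v => ENNReal.ofReal (v ^ 2)⁻¹

instance : SFinite scaleMeasure := by unfold scaleMeasure; infer_instance

/-- The left Haar measure `dν = v⁻² du dv` of the affine group `G = {(u, v) : u ∈ ℝ, v > 0}`,
as a measure on `ℝ × ℝ` that is carried by `G`. -/
def affineMeasure : Measure (ℝ × ℝ) := (volume : Measure ℝ).prod scaleMeasure

/-- The dilation `g_v(x) = v^{-1/2} g(x / v)`. -/
def dilation (v : ℝ) (g : ℝ → ℂ) (x : ℝ) : ℂ := ((√v)⁻¹ : ℝ) * g (x / v)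

/-- The continuous wavelet transform `(W_k f)(u, v) = (f * ψ^{(k)}_v)(u)`. -/
def waveletTransform (k : ℕ) (f : ℝ → ℂ) (ζ : ℝ × ℝ) : ℂ :=
  (f ⋆[ContinuousLinearMap.mul ℂ ℂ, volume] dilation ζ.2 (wavelet k)) ζ.1

theorem waveletTransform_def (k : ℕ) (f : ℝ → ℂ) (u v : ℝ) :
    waveletTransform k f (u, v) =
      ∫ t, f t * (((√v)⁻¹ : ℝ) * (wavelet k : ℝ → ℂ) ((u - t) / v)) := rfl

theorem ae_scaleMeasure {p : ℝ → Prop} (h : ∀ v, 0 < v → p v) : ∀ᵐ v ∂scaleMeasure, p v := by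
  refine (withDensity_absolutelyContinuous _ _).ae_le ?_
  filter_upwards [ae_restrict_mem measurableSet_Ioi] with v hv using h v hv

theorem ae_affineMeasure {p : ℝ × ℝ → Prop} (h : ∀ u v, 0 < v → p (u, v)) :
    ∀ᵐ ζ ∂affineMeasure, p ζ := by
  have h2 : ∀ᵐ ζ ∂affineMeasure, 0 < ζ.2 :=
    Measure.quasiMeasurePreserving_snd.ae (ae_scaleMeasure fun v hv => hv)
  filter_upwards [h2] with ζ hζ using h ζ.1 ζ.2 hζ

theorem quasiMeasurePreserving_affine (u : ℝ) {v : ℝ} (hv : 0 < v) :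
    Measure.QuasiMeasurePreserving (fun t : ℝ => (u - t) / v) volume volume := by
  refine ⟨by fun_prop, ?_⟩
  have h1 : (fun t : ℝ => (u - t) / v) = (fun t => v⁻¹ * t) ∘ fun t => u - t := by
    ext t; simp [div_eq_inv_mul]
  rw [h1, ← Measure.map_map (by fun_prop) (by fun_prop),
    (Measure.measurePreserving_sub_left volume u).map_eq, Real.map_volume_mul_left (by positivity)]
  exact Measure.smul_absolutelyContinuous

theorem memLp_comp_affine (g : Lp ℂ 2 (volume : Measure ℝ)) (u : ℝ) {v : ℝ} (hv : 0 < v) :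
    MemLp (fun t : ℝ => g ((u - t) / v)) 2 := by
  have h1 : (fun t : ℝ => g ((u - t) / v)) = (fun t => g (v⁻¹ * t)) ∘ fun t => u - t := by
    ext t; simp [div_eq_inv_mul]
  rw [h1]
  refine MemLp.comp_measurePreserving ?_ (Measure.measurePreserving_sub_left volume u)
  have h2 : MemLp g 2 (Measure.map (fun t => v⁻¹ * t) (volume : Measure ℝ)) := by
    rw [Real.map_volume_mul_left (by positivity)]
    exact (Lp.memLp g).smul_measure (by simp)
  exact h2.comp_of_map (by fun_prop)

theorem integrable_waveletTransform (k : ℕ) (f : Lp ℂ 2 (volume : Measure ℝ)) (u : ℝ) {v : ℝ}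
    (hv : 0 < v) :
    Integrable fun t => f t * (((√v)⁻¹ : ℝ) * (wavelet k : ℝ → ℂ) ((u - t) / v)) :=
  (Lp.memLp f).integrable_mul ((memLp_comp_affine (wavelet k) u hv).const_mul _)

theorem waveletTransform_congr (k : ℕ) {f g : ℝ → ℂ} (h : f =ᵐ[volume] g) :
    waveletTransform k f = waveletTransform k g := by
  ext ζ
  refine integral_congr_ae ?_
  filter_upwards [h] with t ht
  simp [ht]

theorem waveletTransform_add (k : ℕ) (f g : Lp ℂ 2 (volume : Measure ℝ)) (u : ℝ) {v : ℝ}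
    (hv : 0 < v) :
    waveletTransform k (f + g : Lp ℂ 2 (volume : Measure ℝ)) (u, v) =
      waveletTransform k f (u, v) + waveletTransform k g (u, v) := by
  rw [waveletTransform_congr k (Lp.coeFn_add f g)]
  simp only [waveletTransform_def]
  rw [← integral_add (integrable_waveletTransform k f u hv) (integrable_waveletTransform k g u hv)]
  simp only [Pi.add_apply, add_mul]

theorem waveletTransform_smul (k : ℕ) (c : ℂ) (f : Lp ℂ 2 (volume : Measure ℝ)) (u v : ℝ) :
    waveletTransform k (c • f : Lp ℂ 2 (volume : Measure ℝ)) (u, v) =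
      c * waveletTransform k f (u, v) := by
  rw [waveletTransform_congr k (Lp.coeFn_smul c f)]
  simp only [waveletTransform_def]
  rw [← integral_const_mul]
  simp only [Pi.smul_apply, smul_eq_mul, mul_assoc]

/-- The wavelet subspace `A^{(k)} = {W_k f : f ∈ H₂⁺(ℝ)}` of `L₂(G, dν)`. -/
def waveletSubspace (k : ℕ) : Submodule ℂ (Lp ℂ 2 affineMeasure) where
  carrier := {F | ∃ f ∈ hardySpace, F =ᵐ[affineMeasure] waveletTransform k f}
  zero_mem' := by
    refine ⟨0, hardySpace.zero_mem, ?_⟩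
    filter_upwards [Lp.coeFn_zero ℂ 2 affineMeasure] with ζ h
    have h0 := waveletTransform_smul k 0 0 ζ.1 ζ.2
    rw [zero_smul, zero_mul] at h0
    rw [h, Pi.zero_apply]
    exact h0.symm
  add_mem' := by
    rintro F G ⟨f, hf, hF⟩ ⟨g, hg, hG⟩
    refine ⟨f + g, hardySpace.add_mem hf hg, ?_⟩
    filter_upwards [hF, hG, Lp.coeFn_add F G,
      ae_affineMeasure (p := fun ζ => waveletTransform k (f + g : Lp ℂ 2 (volume : Measure ℝ)) ζ =
        waveletTransform k f ζ + waveletTransform k g ζ)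
        fun u v hv => waveletTransform_add k f g u hv] with ζ h1 h2 h3 h4
    rw [h3, Pi.add_apply, h1, h2, ← h4]
  smul_mem' := by
    rintro c F ⟨f, hf, hF⟩
    refine ⟨c • f, hardySpace.smul_mem c hf, ?_⟩
    filter_upwards [hF, Lp.coeFn_smul c F] with ζ h1 h2
    rw [h2, Pi.smul_apply, h1, smul_eq_mul]
    exact (waveletTransform_smul k c f ζ.1 ζ.2).symm

/-! ### The wavelet subspaces are closed

The orthogonal projection onto `A^{(k)}` and the adjoint of an operator on `A^{(k)}` exist because
`W_k` is a multiple of an isometry on `H₂⁺(ℝ)`. -/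

theorem eLpNorm_two_sq {α : Type*} [MeasurableSpace α] (μ : Measure α) (f : α → ℂ) :
    eLpNorm f 2 μ ^ 2 = ∫⁻ x, ‖f x‖ₑ ^ 2 ∂μ := by
  have := eLpNorm_nnreal_pow_eq_lintegral (μ := μ) (f := f) (p := 2) two_ne_zero
  simpa using this

theorem fourierInv_toLp_ae {h : ℝ → ℂ} (h1 : Integrable h) (h2 : MemLp h 2) :
    (𝓕⁻ (h2.toLp h) : Lp ℂ 2 (volume : Measure ℝ)) =ᵐ[volume] (𝓕⁻ h : ℝ → ℂ) := by
  have hcont : Continuous (𝓕⁻ h : ℝ → ℂ) :=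
    VectorFourier.fourierIntegral_continuous Real.continuous_fourierChar
      (L := -innerₗ ℝ) (by simp only [LinearMap.neg_apply, innerₗ_apply_apply]; exact continuous_inner.neg) h1
  refine ae_eq_of_integral_contDiff_smul_eq
    ((Lp.memLp _).locallyIntegrable (by norm_num)) hcont.locallyIntegrable fun g hg hc => ?_
  have hc' : HasCompactSupport fun x => (g x : ℂ) := hc.comp_left (g := fun y : ℝ => (y : ℂ)) rfl
  have hg' : ContDiff ℝ (⊤ : ℕ∞) fun x => (g x : ℂ) := Complex.ofRealCLM.contDiff.comp hg
  have key := DFunLike.congr_fun (Lp.fourierInv_toTemperedDistribution_eq (h2.toLp h))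
    (hc'.toSchwartzMap hg')
  rw [TemperedDistribution.fourierInv_apply, Lp.toTemperedDistribution_apply,
    Lp.toTemperedDistribution_apply] at key
  have e1 : ∫ x : ℝ, (𝓕⁻ (hc'.toSchwartzMap hg') : SchwartzMap ℝ ℂ) x • (h2.toLp h) x =
      ∫ x : ℝ, (𝓕⁻ (fun x => (g x : ℂ)) : ℝ → ℂ) x • h x := by
    refine integral_congr_ae ?_
    filter_upwards [h2.coeFn_toLp] with x hx
    rw [hx, SchwartzMap.fourierInv_coe]
    rfl
  have e2 : ∫ x : ℝ, (𝓕⁻ (fun x => (g x : ℂ)) : ℝ → ℂ) x • h x =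
      ∫ x : ℝ, (g x : ℂ) • (𝓕⁻ h : ℝ → ℂ) x := by
    have hgi : Integrable fun x => (g x : ℂ) := hg'.continuous.integrable_of_hasCompactSupport hc'
    have := VectorFourier.integral_fourierIntegral_smul_eq_flip (L := -innerₗ ℝ)
      (μ := volume) (ν := volume) Real.continuous_fourierChar
      (by simp only [LinearMap.neg_apply, innerₗ_apply_apply]; exact continuous_inner.neg) hgi h1
    rwa [show (-innerₗ ℝ).flip = -innerₗ ℝ by ext; simp] at this
  have e3 : ∫ x : ℝ, (hc'.toSchwartzMap hg') x • (𝓕⁻ (h2.toLp h) : Lp ℂ 2 (volume : Measure ℝ)) x =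
      ∫ x : ℝ, g x • (𝓕⁻ (h2.toLp h) : Lp ℂ 2 (volume : Measure ℝ)) x := by
    refine integral_congr_ae (.of_forall fun x => ?_)
    exact Complex.coe_smul (g x) _
  rw [← e3, ← key, e1, e2]
  refine integral_congr_ae (.of_forall fun x => ?_)
  exact Complex.coe_smul (g x) _

theorem waveletTransform_eq_fourierInv (k : ℕ) (f : Lp ℂ 2 (volume : Measure ℝ)) (u : ℝ) {v : ℝ}
    (hv : 0 < v) :
    waveletTransform k f (u, v) = 𝓕⁻ (fun ξ : ℝ => ((√v : ℝ) : ℂ) * waveletHat k (v * ξ) *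
      (𝓕 f : Lp ℂ 2 (volume : Measure ℝ)) ξ) u := by
  -- the function on the Fourier side whose inverse transform is the reflected, translated wavelet
  have hv' : v ≠ 0 := hv.ne'
  let G : ℝ → ℂ := fun ξ => ((√v : ℝ) : ℂ) * waveletHat k (v * ξ) *
    Complex.exp (((-(2 * Real.pi * (u * ξ)) : ℝ) : ℂ) * Complex.I)
  have hGm : Measurable G := by
    have := measurable_waveletHat k
    fun_prop
  have hGn : ∀ ξ, ‖G ξ‖ = √v * ‖waveletHat k (v * ξ)‖ := fun ξ => by
    simp only [G, norm_mul, Complex.norm_exp_ofReal_mul_I, mul_one, Complex.norm_real,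
      Real.norm_eq_abs, abs_of_nonneg (Real.sqrt_nonneg v)]
  have hG1 : Integrable G := by
    have := (((integrable_waveletHat k).comp_mul_left' hv').norm.const_mul (√v))
    exact this.mono' hGm.aestronglyMeasurable (.of_forall fun ξ => (hGn ξ).le)
  have hG2 : MemLp G 2 := by
    rw [memLp_two_iff_integrable_sq_norm hGm.aestronglyMeasurable]
    simp only [pow_two]
    refine hG1.norm.bdd_mul (c := √v * (3 * 9 ^ k))
      hGm.norm.aestronglyMeasurable (.of_forall fun ξ => ?_)
    rw [norm_norm, hGn]
    gcongr
    exact norm_waveletHat_le_const k _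
  have hconj : ∀ y, (starRingEnd ℂ) (waveletHat k y) = waveletHat k y := fun y => by
    unfold waveletHat
    by_cases hy : y ∈ Ioi (0 : ℝ)
    · rw [indicator_of_mem hy, Complex.conj_ofReal]
    · rw [indicator_of_notMem hy, map_zero]
  have hψ := fourierInv_toLp_ae (integrable_waveletHat k) (memLp_waveletHat k)
  have hψ' := (quasiMeasurePreserving_affine u hv).ae hψ
  have hg := fourierInv_toLp_ae hG1 hG2
  have hpt : ∀ t : ℝ, (starRingEnd ℂ) ((𝓕⁻ G : ℝ → ℂ) t) =
      ((√v)⁻¹ : ℝ) * (𝓕⁻ (waveletHat k) : ℝ → ℂ) ((u - t) / v) := fun t => by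
    rw [Real.fourierInv_eq', Real.fourierInv_eq', ← integral_conj, ← integral_const_mul]
    have hsub := Measure.integral_comp_mul_left (fun η : ℝ => (((√v)⁻¹ : ℝ) : ℂ) *
      (Complex.exp (((2 * Real.pi * inner ℝ η ((u - t) / v) : ℝ) : ℂ) * Complex.I) •
        waveletHat k η)) v
    have hsub' : ∫ η : ℝ, (((√v)⁻¹ : ℝ) : ℂ) *
      (Complex.exp (((2 * Real.pi * inner ℝ η ((u - t) / v) : ℝ) : ℂ) * Complex.I) •
        waveletHat k η) = v • ∫ ξ : ℝ, (((√v)⁻¹ : ℝ) : ℂ) *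
      (Complex.exp (((2 * Real.pi * inner ℝ (v * ξ) ((u - t) / v) : ℝ) : ℂ) * Complex.I) •
        waveletHat k (v * ξ)) := by
      rw [hsub, smul_smul, abs_of_pos (by positivity), mul_inv_cancel₀ hv', one_smul]
    rw [hsub', ← integral_smul]
    refine integral_congr_ae (.of_forall fun ξ => ?_)
    have hs : (v : ℂ) * (((√v)⁻¹ : ℝ) : ℂ) = ((√v : ℝ) : ℂ) := by
      rw [← Complex.ofReal_mul]
      congr 1
      rw [← div_eq_mul_inv, Real.div_sqrt]
    have he : (starRingEnd ℂ) (Complex.exp (((2 * Real.pi * inner ℝ ξ t : ℝ) : ℂ) * Complex.I)) *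
        (starRingEnd ℂ) (Complex.exp (((-(2 * Real.pi * (u * ξ)) : ℝ) : ℂ) * Complex.I)) =
        Complex.exp (((2 * Real.pi * inner ℝ (v * ξ) ((u - t) / v) : ℝ) : ℂ) * Complex.I) := by
      rw [← Complex.exp_conj, ← Complex.exp_conj, ← Complex.exp_add]
      congr 1
      simp only [map_mul, Complex.conj_ofReal, Complex.conj_I]
      have : (2 * Real.pi * inner ℝ (v * ξ) ((u - t) / v) : ℝ) =
          -(2 * Real.pi * inner ℝ ξ t) - (-(2 * Real.pi * (u * ξ))) := by
        simp only [RCLike.inner_apply, conj_trivial]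
        field_simp
        ring
      rw [this]
      push_cast
      ring
    simp only [smul_eq_mul, map_mul, G, hconj, Complex.conj_ofReal, Complex.real_smul]
    rw [← he, ← hs]
    ring
  have hinner := Lp.inner_fourier_eq (𝓕⁻ (hG2.toLp G) : Lp ℂ 2 (volume : Measure ℝ)) f
  rw [FourierTransform.fourier_fourierInv_eq, L2.inner_def, L2.inner_def] at hinner
  have e1 : waveletTransform k f (u, v) =
      ∫ t, inner ℂ ((𝓕⁻ (hG2.toLp G) : Lp ℂ 2 (volume : Measure ℝ)) t) (f t) := by
    rw [waveletTransform_def]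
    refine integral_congr_ae ?_
    filter_upwards [hψ', hg] with t h1 h2
    rw [h2, RCLike.inner_apply, hpt t]
    unfold wavelet
    rw [h1]
  rw [e1, ← hinner, Real.fourierInv_eq']
  refine integral_congr_ae ?_
  filter_upwards [hG2.coeFn_toLp] with ξ h1
  rw [h1, RCLike.inner_apply]
  simp only [G, map_mul, hconj, Complex.conj_ofReal, smul_eq_mul, ← Complex.exp_conj,
    Complex.conj_I, RCLike.inner_apply, conj_trivial]
  push_cast
  ring_nf

theorem lintegral_waveletTransform_slice (k : ℕ) (f : Lp ℂ 2 (volume : Measure ℝ)) {v : ℝ}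
    (hv : 0 < v) :
    ∫⁻ u, ‖waveletTransform k f (u, v)‖ₑ ^ 2 =
      ∫⁻ ξ : ℝ, ENNReal.ofReal v * ‖waveletHat k (v * ξ)‖ₑ ^ 2 *
        ‖(𝓕 f : Lp ℂ 2 (volume : Measure ℝ)) ξ‖ₑ ^ 2 := by
  have hv' : v ≠ 0 := hv.ne'
  let H : ℝ → ℂ := fun ξ => ((√v : ℝ) : ℂ) * waveletHat k (v * ξ) *
    (𝓕 f : Lp ℂ 2 (volume : Measure ℝ)) ξ
  have hm : Measurable fun ξ : ℝ => ((√v : ℝ) : ℂ) * waveletHat k (v * ξ) := by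
    have := measurable_waveletHat k
    fun_prop
  have hb : ∀ ξ : ℝ, ‖((√v : ℝ) : ℂ) * waveletHat k (v * ξ)‖ ≤ √v * (3 * 9 ^ k) := fun ξ => by
    rw [norm_mul, Complex.norm_real, Real.norm_eq_abs, abs_of_nonneg (Real.sqrt_nonneg v)]
    gcongr
    exact norm_waveletHat_le_const k _
  have hM2 : MemLp (fun ξ : ℝ => ((√v : ℝ) : ℂ) * waveletHat k (v * ξ)) 2 := by
    rw [memLp_two_iff_integrable_sq_norm hm.aestronglyMeasurable]
    simp only [pow_two]
    refine (((integrable_waveletHat k).comp_mul_left' hv').const_mul _).norm.bdd_mul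
      hm.norm.aestronglyMeasurable (.of_forall fun ξ => ?_) (c := √v * (3 * 9 ^ k))
    rw [norm_norm]
    exact hb ξ
  have hH1 : Integrable H := hM2.integrable_mul (Lp.memLp _)
  have hH2 : MemLp H 2 :=
    (Lp.memLp (𝓕 f : Lp ℂ 2 (volume : Measure ℝ))).mul (memLp_top_of_bound hm.aestronglyMeasurable
      _ (.of_forall hb))
  have e1 : eLpNorm (fun u => waveletTransform k f (u, v)) 2 volume = eLpNorm H 2 volume := by
    have h1 : (fun u => waveletTransform k f (u, v)) = (𝓕⁻ H : ℝ → ℂ) := by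
      ext u
      exact waveletTransform_eq_fourierInv k f u hv
    have h2 : ‖(𝓕⁻ (hH2.toLp H) : Lp ℂ 2 (volume : Measure ℝ))‖ = ‖hH2.toLp H‖ :=
      (Lp.fourierTransformₗᵢ ℝ ℂ).symm.norm_map _
    rw [h1, ← eLpNorm_congr_ae (fourierInv_toLp_ae hH1 hH2), ← eLpNorm_congr_ae hH2.coeFn_toLp]
    rw [Lp.norm_def, Lp.norm_def] at h2
    exact (ENNReal.toReal_eq_toReal_iff' (Lp.eLpNorm_ne_top _) (Lp.eLpNorm_ne_top _)).1 h2
  rw [← eLpNorm_two_sq, e1, eLpNorm_two_sq]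
  refine lintegral_congr fun ξ => ?_
  simp only [H, enorm_mul, mul_pow]
  congr 2
  rw [← ofReal_norm, Complex.norm_real, Real.norm_eq_abs, abs_of_nonneg (Real.sqrt_nonneg v),
    ← ENNReal.ofReal_pow (Real.sqrt_nonneg v), Real.sq_sqrt hv.le]

theorem measurable_waveletTransform (k : ℕ) (f : Lp ℂ 2 (volume : Measure ℝ)) :
    StronglyMeasurable (waveletTransform k f) := by
  have hf : StronglyMeasurable (f : ℝ → ℂ) := Lp.stronglyMeasurable f
  have hw : StronglyMeasurable (wavelet k : ℝ → ℂ) := Lp.stronglyMeasurable _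
  have h : StronglyMeasurable fun p : (ℝ × ℝ) × ℝ =>
      f p.2 * ((((√p.1.2)⁻¹ : ℝ) : ℂ) * (wavelet k : ℝ → ℂ) ((p.1.1 - p.2) / p.1.2)) := by
    have h1 := hf.comp_measurable (measurable_snd : Measurable fun p : (ℝ × ℝ) × ℝ => p.2)
    have h2 := hw.comp_measurable
      (by fun_prop : Measurable fun p : (ℝ × ℝ) × ℝ => (p.1.1 - p.2) / p.1.2)
    have h3 : StronglyMeasurable fun p : (ℝ × ℝ) × ℝ => (((√p.1.2)⁻¹ : ℝ) : ℂ) :=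
      Measurable.stronglyMeasurable (by fun_prop)
    exact h1.mul (h3.mul h2)
  exact h.integral_prod_right

/-- The constant `∫_0^∞ |ψ̂(y)|² dy / y` (it equals `1`, but this is not needed here). -/
def waveletConst (k : ℕ) : ℝ≥0∞ :=
  ∫⁻ y : ℝ, ENNReal.ofReal y⁻¹ * ‖waveletHat k y‖ₑ ^ 2

theorem waveletConst_ne_top (k : ℕ) : waveletConst k ≠ ⊤ := by
  have hb : ∀ y : ℝ, ENNReal.ofReal y⁻¹ * ‖waveletHat k y‖ₑ ^ 2 ≤ ENNReal.ofReal
      ((Ioi (0 : ℝ)).indicator (fun y => 2 * (9 ^ k) ^ 2 * Real.exp (-(3 / 2) * y)) y) := by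
    intro y
    by_cases hy : y ∈ Ioi (0 : ℝ)
    · have h0 : 0 < y := hy
      rw [indicator_of_mem hy, ← ofReal_norm, ← ENNReal.ofReal_pow (norm_nonneg _),
        ← ENNReal.ofReal_mul (by positivity)]
      refine ENNReal.ofReal_le_ofReal ?_
      simp only [waveletHat, indicator_of_mem hy, Complex.norm_real, Real.norm_eq_abs, sq_abs]
      have hl := abs_laguerreFun_le k (y := 2 * y) (by positivity)
      rw [mul_pow, Real.sq_sqrt (by positivity)]
      calc y⁻¹ * (2 * y * laguerreFun k (2 * y) ^ 2) = 2 * |laguerreFun k (2 * y)| ^ 2 := by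
            rw [sq_abs]; field_simp
        _ ≤ 2 * (9 ^ k * Real.exp (-(3 / 8) * (2 * y))) ^ 2 := by gcongr
        _ = _ := by
            rw [mul_pow, ← Real.exp_nat_mul]
            ring_nf
    · simp [waveletHat, indicator_of_notMem hy]
  refine ((lintegral_mono hb).trans_lt ?_).ne
  refine (Integrable.lintegral_lt_top ?_)
  rw [integrable_indicator_iff measurableSet_Ioi]
  exact (exp_neg_integrableOn_Ioi 0 (by norm_num)).const_mul _

theorem lintegral_waveletTransform (k : ℕ) {f : Lp ℂ 2 (volume : Measure ℝ)}
    (hf : f ∈ hardySpace) :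
    ∫⁻ ζ, ‖waveletTransform k f ζ‖ₑ ^ 2 ∂affineMeasure =
      waveletConst k * ∫⁻ x, ‖f x‖ₑ ^ 2 := by
  have hmW : Measurable fun ζ : ℝ × ℝ => ‖waveletTransform k f ζ‖ₑ ^ 2 :=
    (measurable_waveletTransform k f).measurable.enorm.pow_const 2
  have hmF : Measurable fun ξ : ℝ => ‖(𝓕 f : Lp ℂ 2 (volume : Measure ℝ)) ξ‖ₑ ^ 2 :=
    (Lp.stronglyMeasurable _).measurable.enorm.pow_const 2
  have hmH := measurable_waveletHat k
  have hd : Measurable fun v : ℝ => ENNReal.ofReal (v ^ 2)⁻¹ := by fun_prop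
  -- the scale integral for a fixed positive frequency
  have hscale : ∀ ξ : ℝ, 0 < ξ →
      ∫⁻ v, ENNReal.ofReal v * ‖waveletHat k (v * ξ)‖ₑ ^ 2 ∂scaleMeasure = waveletConst k := by
    intro ξ hξ
    have hmv : Measurable fun v : ℝ => ENNReal.ofReal v * ‖waveletHat k (v * ξ)‖ₑ ^ 2 := by
      fun_prop
    have hmc : Measurable fun y : ℝ => ENNReal.ofReal y⁻¹ * ‖waveletHat k y‖ₑ ^ 2 := by
      fun_prop
    unfold scaleMeasure
    rw [lintegral_withDensity_eq_lintegral_mul _ hd hmv, ← lintegral_indicator measurableSet_Ioi]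
    have e : ∀ v : ℝ, (Ioi (0 : ℝ)).indicator ((fun v : ℝ => ENNReal.ofReal (v ^ 2)⁻¹) *
        fun v : ℝ => ENNReal.ofReal v * ‖waveletHat k (v * ξ)‖ₑ ^ 2) v =
        ENNReal.ofReal ξ *
          (ENNReal.ofReal (ξ * v)⁻¹ * ‖waveletHat k (ξ * v)‖ₑ ^ 2) := by
      intro v
      by_cases hv : v ∈ Ioi (0 : ℝ)
      · have h0 : 0 < v := hv
        rw [indicator_of_mem hv, Pi.mul_apply, ← mul_assoc, ← mul_assoc,
          ← ENNReal.ofReal_mul (by positivity), ← ENNReal.ofReal_mul (by positivity), mul_comm v ξ]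
        congr 2
        field_simp
      · have h0 : ¬ (0 < v) := hv
        have h1 : ξ * v ∉ Ioi (0 : ℝ) := fun h => h0 (pos_of_mul_pos_right h hξ.le)
        rw [indicator_of_notMem hv, waveletHat, indicator_of_notMem h1]
        simp
    simp only [e]
    rw [lintegral_const_mul _ (by fun_prop)]
    have hmap : ∫⁻ v : ℝ, (ENNReal.ofReal (ξ * v)⁻¹ * ‖waveletHat k (ξ * v)‖ₑ ^ 2) =
        ENNReal.ofReal ξ⁻¹ * waveletConst k := by
      rw [← lintegral_map (f := fun y : ℝ => ENNReal.ofReal y⁻¹ * ‖waveletHat k y‖ₑ ^ 2)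
        (g := fun v => ξ * v) hmc (by fun_prop), Real.map_volume_mul_left hξ.ne',
        lintegral_smul_measure, abs_of_pos (by positivity)]
      rfl
    rw [hmap, ← mul_assoc, ← ENNReal.ofReal_mul hξ.le, mul_inv_cancel₀ hξ.ne', ENNReal.ofReal_one,
      one_mul]
  have hnorm : ∫⁻ ξ, ‖(𝓕 f : Lp ℂ 2 (volume : Measure ℝ)) ξ‖ₑ ^ 2 = ∫⁻ x, ‖f x‖ₑ ^ 2 := by
    rw [← eLpNorm_two_sq, ← eLpNorm_two_sq]
    have h2 := Lp.norm_fourier_eq f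
    rw [Lp.norm_def, Lp.norm_def] at h2
    rw [(ENNReal.toReal_eq_toReal_iff' (Lp.eLpNorm_ne_top _) (Lp.eLpNorm_ne_top _)).1 h2]
  unfold affineMeasure
  rw [lintegral_prod_symm' _ hmW]
  have e1 : ∫⁻ v, ∫⁻ u, ‖waveletTransform k f (u, v)‖ₑ ^ 2 ∂volume ∂scaleMeasure =
      ∫⁻ v, ∫⁻ ξ : ℝ, ENNReal.ofReal v * ‖waveletHat k (v * ξ)‖ₑ ^ 2 *
        ‖(𝓕 f : Lp ℂ 2 (volume : Measure ℝ)) ξ‖ₑ ^ 2 ∂volume ∂scaleMeasure :=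
    lintegral_congr_ae (ae_scaleMeasure fun v hv => lintegral_waveletTransform_slice k f hv)
  have hm2 : Measurable (Function.uncurry fun (v ξ : ℝ) =>
      ENNReal.ofReal v * ‖waveletHat k (v * ξ)‖ₑ ^ 2 *
        ‖(𝓕 f : Lp ℂ 2 (volume : Measure ℝ)) ξ‖ₑ ^ 2) := by
    have h2 := hmF.comp (measurable_snd : Measurable fun p : ℝ × ℝ => p.2)
    refine Measurable.mul ?_ h2
    fun_prop
  rw [e1, lintegral_lintegral_swap hm2.aemeasurable, ← hnorm, ← lintegral_const_mul _ hmF]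
  refine lintegral_congr_ae ?_
  have hne : ∀ᵐ ξ : ℝ, ξ ≠ 0 := by simp [ae_iff]
  filter_upwards [hf, hne] with ξ h1 h2
  rcases lt_or_gt_of_ne h2 with h3 | h3
  · simp [h1 h3]
  · rw [lintegral_mul_const _ (by fun_prop), hscale ξ h3]

theorem memLp_waveletTransform (k : ℕ) {f : Lp ℂ 2 (volume : Measure ℝ)} (hf : f ∈ hardySpace) :
    MemLp (waveletTransform k f) 2 affineMeasure := by
  refine ⟨(measurable_waveletTransform k f).aestronglyMeasurable, ?_⟩
  have h := lintegral_waveletTransform k hf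
  rw [← eLpNorm_two_sq, ← eLpNorm_two_sq] at h
  have h2 : eLpNorm (waveletTransform k f) 2 affineMeasure ^ 2 ≠ ⊤ := by
    rw [h]
    exact ENNReal.mul_ne_top (waveletConst_ne_top k) (ENNReal.pow_ne_top (Lp.eLpNorm_ne_top f))
  rw [lt_top_iff_ne_top]
  intro h3
  rw [h3] at h2
  simp at h2

theorem isClosed_hardySpace : IsClosed (hardySpace : Set (Lp ℂ 2 (volume : Measure ℝ))) := by
  let R := LpToLpRestrictCLM ℝ ℂ ℂ (volume : Measure ℝ) 2 (Iio 0)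
  have e : (hardySpace : Set (Lp ℂ 2 (volume : Measure ℝ))) =
      {f | R (Lp.fourierTransformₗᵢ ℝ ℂ f) = 0} := by
    ext f
    have h1 := LpToLpRestrictCLM_coeFn ℂ (Iio 0) (Lp.fourierTransformₗᵢ ℝ ℂ f)
    change (∀ᵐ ξ : ℝ, ξ < 0 → (Lp.fourierTransformₗᵢ ℝ ℂ f) ξ = 0) ↔ R _ = 0
    rw [Lp.eq_zero_iff_ae_eq_zero]
    have h2 : (∀ᵐ ξ : ℝ, ξ < 0 → (Lp.fourierTransformₗᵢ ℝ ℂ f) ξ = 0) ↔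
        ∀ᵐ ξ ∂(volume.restrict (Iio (0 : ℝ))), (Lp.fourierTransformₗᵢ ℝ ℂ f) ξ = 0 :=
      (ae_restrict_iff' measurableSet_Iio).symm
    rw [h2]
    constructor
    · intro h
      filter_upwards [h, h1] with ξ h3 h4
      exact h4.trans h3
    · intro h
      filter_upwards [h, h1] with ξ h3 h4
      exact h4.symm.trans h3
  rw [e]
  exact isClosed_eq (R.continuous.comp (Lp.fourierTransformₗᵢ ℝ ℂ).continuous) continuous_const

instance completeSpace_waveletSubspace (k : ℕ) : CompleteSpace (waveletSubspace k) := by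
  have : CompleteSpace hardySpace := isClosed_hardySpace.completeSpace_coe
  let J : hardySpace → Lp ℂ 2 affineMeasure := fun f => (memLp_waveletTransform k f.2).toLp _
  have hJ : ∀ f : hardySpace, J f =ᵐ[affineMeasure] waveletTransform k f.1 :=
    fun f => (memLp_waveletTransform k f.2).coeFn_toLp
  have hadd : ∀ f g, J (f + g) = J f + J g := fun f g => by
    refine Lp.ext ?_
    filter_upwards [hJ f, hJ g, hJ (f + g), Lp.coeFn_add (J f) (J g), ae_affineMeasure
      (p := fun ζ => waveletTransform k (f.1 + g.1 : Lp ℂ 2 (volume : Measure ℝ)) ζ =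
        waveletTransform k f.1 ζ + waveletTransform k g.1 ζ)
      fun u v hv => waveletTransform_add k f.1 g.1 u hv] with ζ h1 h2 h3 h4 h5
    rw [h4, Pi.add_apply, h1, h2, h3]
    exact h5
  let J' : hardySpace →+ Lp ℂ 2 affineMeasure := AddMonoidHom.mk' J hadd
  set c : ℝ := √(waveletConst k).toReal with hc
  have hn : ∀ f : hardySpace, ‖J' f‖ = c * ‖f‖ := fun f => by
    have h := lintegral_waveletTransform k f.2
    rw [← eLpNorm_two_sq, ← eLpNorm_two_sq, ← eLpNorm_congr_ae (hJ f)] at h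
    have h' := congrArg ENNReal.toReal h
    rw [ENNReal.toReal_mul, ENNReal.toReal_pow, ENNReal.toReal_pow, ← Lp.norm_def,
      ← Lp.norm_def] at h'
    have h3 : ‖J f‖ = √(‖J f‖ ^ 2) := (Real.sqrt_sq (norm_nonneg _)).symm
    change ‖J f‖ = c * ‖f.1‖
    rw [h3, h', Real.sqrt_mul ENNReal.toReal_nonneg, Real.sqrt_sq (norm_nonneg _)]
  have hr : (waveletSubspace k : Set (Lp ℂ 2 affineMeasure)) = range J' := by
    ext F
    constructor
    · rintro ⟨f, hf, hF⟩
      exact ⟨⟨f, hf⟩, Lp.ext ((hJ ⟨f, hf⟩).trans hF.symm)⟩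
    · rintro ⟨f, rfl⟩
      exact ⟨f.1, f.2, hJ f⟩
  have hcomp : IsComplete (waveletSubspace k : Set (Lp ℂ 2 affineMeasure)) := by
    rw [hr]
    by_cases h0 : c = 0
    · have : range J' = {0} := by
        ext F
        simp only [mem_range, mem_singleton_iff]
        constructor
        · rintro ⟨f, rfl⟩
          rw [← norm_eq_zero, hn, h0, zero_mul]
        · rintro rfl
          exact ⟨0, map_zero J'⟩
      rw [this]
      exact isClosed_singleton.isComplete
    · have hc0 : 0 ≤ c := Real.sqrt_nonneg _
      have ha : AntilipschitzWith (⟨c, hc0⟩ : NNReal)⁻¹ J' :=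
        AddMonoidHomClass.antilipschitz_of_bound J' fun f => by
          rw [hn]
          change ‖f‖ ≤ c⁻¹ * (c * ‖f‖)
          rw [inv_mul_cancel_left₀ h0]
      exact ha.isComplete_range (AddMonoidHomClass.uniformContinuous_of_bound J' c
        fun f => (hn f).le)
  exact hcomp.completeSpace_coe

/-! ### Calderón–Toeplitz operators with symbols that depend on `v` only -/

/-- Lebesgue measure on the half-line `ℝ_+ = (0, +∞)`. -/
abbrev halfLine : Measure ℝ := volume.restrict (Ioi 0)

theorem memLp_symbol (a : Lp ℂ ∞ halfLine) :
    MemLp (fun ζ : ℝ × ℝ => a ζ.2) ∞ affineMeasure := by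
  have h1 : Measure.QuasiMeasurePreserving (Prod.snd : ℝ × ℝ → ℝ) affineMeasure halfLine :=
    ⟨measurable_snd, (Measure.quasiMeasurePreserving_snd (μ := (volume : Measure ℝ))
      (ν := scaleMeasure)).absolutelyContinuous.trans (withDensity_absolutelyContinuous _ _)⟩
  refine memLp_top_of_bound ((Lp.aestronglyMeasurable a).comp_quasiMeasurePreserving h1) ‖a‖ ?_
  refine h1.ae (p := fun v => ‖a v‖ ≤ ‖a‖) ?_
  have h2 := Lp.norm_def a
  rw [eLpNorm_exponent_top] at h2
  rw [h2]
  filter_upwards [enorm_ae_le_eLpNormEssSup a halfLine] with v hv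
  rw [← toReal_enorm]
  refine ENNReal.toReal_mono ?_ hv
  rw [← eLpNorm_exponent_top]
  exact Lp.eLpNorm_ne_top a

/-- The operator of pointwise multiplication by the symbol `(u, v) ↦ a v` on `L₂(G, dν)`. -/
def mulOperator (a : Lp ℂ ∞ halfLine) : Lp ℂ 2 affineMeasure →L[ℂ] Lp ℂ 2 affineMeasure :=
  (ContinuousLinearMap.mul ℂ ℂ).holderL affineMeasure ∞ 2 2 ((memLp_symbol a).toLp _)

/-- The Calderón–Toeplitz operator `T_a^{(k)} = P^{(k)} M_a` on `A^{(k)}`, where `P^{(k)}` is the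
orthogonal projection of `L₂(G, dν)` onto `A^{(k)}`. -/
def toeplitz (k : ℕ) (a : Lp ℂ ∞ halfLine) : waveletSubspace k →L[ℂ] waveletSubspace k :=
  (waveletSubspace k).orthogonalProjectionOnto ∘L mulOperator a ∘L (waveletSubspace k).subtypeL

/-- The C*-algebra generated by a subset of a unital C*-algebra: the norm closure of the
*-algebra generated by the subset and the identity. -/
def generatedCStarAlgebra {A : Type*} [CStarAlgebra A] (X : Set A) : StarSubalgebra ℂ A :=
  (StarAlgebra.adjoin ℂ X).topologicalClosure

theorem subset_generatedCStarAlgebra {A : Type*} [CStarAlgebra A] (X : Set A) :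
    X ⊆ generatedCStarAlgebra X :=
  (StarAlgebra.subset_adjoin ℂ X).trans (StarSubalgebra.le_topologicalClosure _)

/-- The C*-algebra `𝒯_k(S)` of bounded operators on `A^{(k)}` that is generated by the operators
`T_a^{(k)}` with `a ∈ S`. (For the symbols below it contains the identity `T_1^{(k)}` anyway.) -/
def toeplitzAlgebra (k : ℕ) (S : Set (Lp ℂ ∞ halfLine)) :
    StarSubalgebra ℂ (waveletSubspace k →L[ℂ] waveletSubspace k) :=
  generatedCStarAlgebra (toeplitz k '' S)

theorem toeplitz_mem (k : ℕ) {S : Set (Lp ℂ ∞ halfLine)} {a : Lp ℂ ∞ halfLine} (ha : a ∈ S) :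
    toeplitz k a ∈ toeplitzAlgebra k S :=
  subset_generatedCStarAlgebra _ (mem_image_of_mem _ ha)

/-- The set `L_∞^{{0,+∞}}(ℝ_+)` of those `a ∈ L_∞(ℝ_+)` that have limits at `0` and at `+∞`, which
means that some function in the class of `a` has them. -/
def symbolsWithLimits : Set (Lp ℂ ∞ halfLine) :=
  {a | ∃ (g : ℝ → ℂ) (a₀ aInf : ℂ), a =ᵐ[halfLine] g ∧
    Tendsto g (𝓝[>] 0) (𝓝 a₀) ∧ Tendsto g atTop (𝓝 aInf)}

/-- The function `γ_{a,k}(ξ) = ∫_{ℝ_+} a(v / (2ξ)) ℓ_k(v)² dv`, for `ξ > 0`. -/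
def gamma (k : ℕ) (a : Lp ℂ ∞ halfLine) (ξ : ℝ) : ℂ :=
  ∫ v in Ioi (0 : ℝ), a (v / (2 * ξ)) * ((laguerreFun k v ^ 2 : ℝ) : ℂ)

end CalderonToeplitz

end

noncomputable section

namespace CalderonToeplitz

/-! ### The Laguerre functions are normalized -/

/-! For fixed `v` the function `u ↦ W_k f(u, v)` has Fourier transform `√v ψ̂(vξ) 𝓕f(ξ)`. Plancherel
in `u` and Fubini therefore turn the integral of `a(v) |W_k f|²` over `G` into `∫ γ_{a,k}(ξ)
|𝓕f(ξ)|² dξ` (`integral_symbol_mul_waveletTransform`). For `a = 1` the weight is `∫ ℓ_k² = 1`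
(`integral_laguerreFun_sq`), so `W_k` is unitary from `H₂⁺` onto `A^{(k)}`, and `R = 𝓕 W_k⁻¹`
identifies `A^{(k)}` with the functions in `L₂(ℝ)` vanishing on the negative half-line. A bounded
operator on a complex Hilbert space is determined by its quadratic form, so `R` carries `T_a^{(k)}`
to multiplication by `γ_{a,k}` (`toeplitz_eq_diagonalOperator`).

The number `γ_{a,k}(ξ)` is the average of `a` against the probability density `2ξ ℓ_k(2ξv)² dv`. It
depends continuously on `ξ`; the density concentrates at `v = 0` as `ξ → ∞` and escapes to `+∞` as
`ξ → 0`. Limits of `a` at the two ends thus give limits of `γ_{a,k}` at the opposite ends, and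
`γ_{a,k}` extends to `C[0, +∞]`, modelled by `C(ℝ≥0∞, ℂ)`.

Multiplication operators give an injective *-homomorphism of `C[0, +∞]` into the operators on
`A^{(k)}`. It is isometric, and its closed range contains every `T_a^{(k)}`. Conversely, the single
symbol `χ_(0,1)` has `γ(ξ) = ∫_0^{2ξ} ℓ_k²`, which is strictly increasing because `ℓ_k` has finitely
many zeros. By Stone–Weierstrass this injective function already generates `C[0, +∞]`, so the range
is exactly the Toeplitz algebra (`range_diagonalHom`) and `τ_k` is the inverse map. The same
generator gives uniqueness, since a continuous *-homomorphism is determined by its value there. -/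

/-- Up to the sign `(-1)^k` the sum is the `k`-th forward difference of `x ↦ x.choose i` at `x = i`.
The first `i` differences reduce this function to the constant `1`, and any further difference kills
it. -/
theorem sum_neg_one_pow_mul_choose_mul_choose {k i : ℕ} (hi : i ≤ k) :
    ∑ j ∈ Finset.range (k + 1), (-1 : ℤ) ^ j * k.choose j * (i + j).choose i =
      if i = k then (-1) ^ k else 0 := by
  have h1 := fwdDiff_iter_eq_sum_shift (1 : ℕ) (fun x => (x.choose i : ℤ)) k i
  have h2 : (fwdDiff (1 : ℕ))^[k] (fun x => (x.choose i : ℤ)) i = if i = k then 1 else 0 := by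
    obtain ⟨m, rfl⟩ := Nat.exists_eq_add_of_le hi
    have h3 := fwdDiff_iter_choose 0 i
    simp only [add_zero, Nat.choose_zero_right, Nat.cast_one] at h3
    rw [add_comm i m, Function.iterate_add_apply, h3]
    rcases m with _ | m
    · simp
    · rw [Function.iterate_succ_apply, fwdDiff_const]
      have h4 : ∀ n : ℕ, (fwdDiff (1 : ℕ))^[n] (fun _ : ℕ => (0 : ℤ)) = fun _ => 0 := fun n => by
        induction n with
        | zero => rfl
        | succ n ih => rw [Function.iterate_succ_apply, fwdDiff_const, ih]
      rw [h4]
      simp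
  rw [h2] at h1
  have h5 : ∑ j ∈ Finset.range (k + 1), (-1 : ℤ) ^ j * k.choose j * (i + j).choose i =
      (-1) ^ k * ∑ j ∈ Finset.range (k + 1), ((-1 : ℤ) ^ (k - j) * k.choose j) •
        (((i + j • 1).choose i : ℕ) : ℤ) := by
    rw [Finset.mul_sum]
    refine Finset.sum_congr rfl fun j hj => ?_
    have hjk : j ≤ k := Nat.lt_succ_iff.1 (Finset.mem_range.1 hj)
    have h6 : (-1 : ℤ) ^ k * (-1) ^ (k - j) = (-1) ^ j := by
      rw [← pow_add, show k + (k - j) = 2 * (k - j) + j by omega, pow_add, pow_mul]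
      simp
    rw [smul_eq_mul, smul_eq_mul, mul_one, ← mul_assoc, ← mul_assoc, h6]
  rw [h5, ← h1]
  split_ifs <;> simp

theorem integrableOn_pow_mul_exp_neg (n : ℕ) :
    IntegrableOn (fun y : ℝ => y ^ n * Real.exp (-y)) (Ioi 0) := by
  have h := Real.GammaIntegral_convergent (s := (n : ℝ) + 1) (by positivity)
  refine h.congr_fun (fun y _ => ?_) measurableSet_Ioi
  simp only [add_sub_cancel_right, Real.rpow_natCast]
  ring

theorem integral_pow_mul_exp_neg (n : ℕ) :
    ∫ y in Ioi (0 : ℝ), y ^ n * Real.exp (-y) = n.factorial := by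
  rw [← Real.Gamma_nat_eq_factorial, Real.Gamma_eq_integral (by positivity)]
  refine setIntegral_congr_fun measurableSet_Ioi fun y _ => ?_
  simp only [add_sub_cancel_right, Real.rpow_natCast]
  ring

theorem laguerreFun_sq (k : ℕ) (y : ℝ) :
    laguerreFun k y ^ 2 = ∑ i ∈ Finset.range (k + 1), ∑ j ∈ Finset.range (k + 1),
      ((-1) ^ i * (k.choose i : ℝ) / i.factorial * ((-1) ^ j * (k.choose j : ℝ) / j.factorial)) *
        (y ^ (i + j) * Real.exp (-y)) := by
  unfold laguerreFun laguerre
  rw [mul_pow, ← Real.exp_nat_mul, pow_two (∑ i ∈ _, _), Finset.sum_mul_sum, Finset.mul_sum]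
  refine Finset.sum_congr rfl fun i _ => ?_
  rw [Finset.mul_sum]
  refine Finset.sum_congr rfl fun j _ => ?_
  rw [show ((2 : ℕ) : ℝ) * (-y / 2) = -y by push_cast; ring, pow_add]
  ring

theorem integrableOn_laguerreFun_sq (k : ℕ) :
    IntegrableOn (fun y => laguerreFun k y ^ 2) (Ioi 0) := by
  simp only [laguerreFun_sq]
  exact integrable_finsetSum _ fun i _ => integrable_finsetSum _ fun j _ =>
    (integrableOn_pow_mul_exp_neg (i + j)).const_mul _

/-- Orthogonality of `L_k` to lower powers: the moments are factorials, and `(i+j)! = C(i+j, i) i!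
j!` turns the inner sum over `j` into the alternating binomial sum. Only `i = k` survives, with
value `(-1)^k (-1)^k = 1`. -/
theorem integral_laguerreFun_sq (k : ℕ) : ∫ y in Ioi (0 : ℝ), laguerreFun k y ^ 2 = 1 := by
  simp only [laguerreFun_sq]
  rw [integral_finsetSum _ fun i _ => integrable_finsetSum _ fun j _ =>
    (integrableOn_pow_mul_exp_neg (i + j)).const_mul _]
  have h1 : ∀ i ∈ Finset.range (k + 1), ∫ y in Ioi (0 : ℝ), ∑ j ∈ Finset.range (k + 1),
      ((-1) ^ i * (k.choose i : ℝ) / i.factorial * ((-1) ^ j * (k.choose j : ℝ) / j.factorial)) *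
        (y ^ (i + j) * Real.exp (-y)) = if i = k then 1 else 0 := fun i hi => by
    have hik : i ≤ k := Nat.lt_succ_iff.1 (Finset.mem_range.1 hi)
    rw [integral_finsetSum _ fun j _ => (integrableOn_pow_mul_exp_neg (i + j)).const_mul _]
    have h2 : ∀ j ∈ Finset.range (k + 1), ∫ y in Ioi (0 : ℝ),
        ((-1) ^ i * (k.choose i : ℝ) / i.factorial * ((-1) ^ j * (k.choose j : ℝ) / j.factorial)) *
        (y ^ (i + j) * Real.exp (-y)) = (-1) ^ i * (k.choose i : ℝ) *
          (((-1 : ℤ) ^ j * k.choose j * (i + j).choose i : ℤ) : ℝ) := fun j _ => by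
      rw [integral_const_mul, integral_pow_mul_exp_neg]
      have h3 : ((i + j).factorial : ℝ) = (i + j).choose i * i.factorial * j.factorial := by
        rw [← Nat.add_choose_mul_factorial_mul_factorial i j, Nat.choose_symm_add]
        push_cast
        ring
      rw [h3]
      push_cast
      have : (i.factorial : ℝ) ≠ 0 := by positivity
      have : (j.factorial : ℝ) ≠ 0 := by positivity
      field_simp
    rw [Finset.sum_congr rfl h2, ← Finset.mul_sum, ← Int.cast_sum,
      sum_neg_one_pow_mul_choose_mul_choose hik]
    split_ifs with h
    · rw [h, Nat.choose_self]
      push_cast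
      rw [mul_one, ← mul_pow]
      norm_num
    · simp
  rw [Finset.sum_congr rfl h1, Finset.sum_ite_eq']
  simp

theorem finite_laguerreFun_eq_zero (k : ℕ) : {y | laguerreFun k y = 0}.Finite := by
  let p : Polynomial ℝ := ∑ i ∈ Finset.range (k + 1),
    Polynomial.C ((-1) ^ i * (k.choose i : ℝ) / i.factorial) * Polynomial.X ^ i
  have he : ∀ y, p.eval y = laguerre k y := fun y => by
    simp only [p, Polynomial.eval_finsetSum, Polynomial.eval_mul, Polynomial.eval_C,
      Polynomial.eval_pow, Polynomial.eval_X, laguerre]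
    exact Finset.sum_congr rfl fun i _ => by ring
  have hp : p ≠ 0 := fun h => by
    -- The constant term of `L_k` is `1`, so the polynomial is not zero.
    have h0 := he 0
    rw [h, Polynomial.eval_zero, laguerre, Finset.sum_range_succ'] at h0
    simp at h0
  refine (p.roots.toFinset.finite_toSet).subset fun y hy => ?_
  have : laguerre k y = 0 := (mul_eq_zero.1 hy).resolve_left (Real.exp_pos _).ne'
  simp [hp, he, this]

/-- The factor `y⁻¹` cancels the square of `√(2y)`, leaving `∫ 2 ℓ_k(2y)² dy`. This normalization
makes the wavelet transform an isometry. -/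
theorem waveletConst_eq_one (k : ℕ) : waveletConst k = 1 := by
  have h1 : ∀ y : ℝ, ENNReal.ofReal y⁻¹ * ‖waveletHat k y‖ₑ ^ 2 =
      ENNReal.ofReal ((Ioi (0 : ℝ)).indicator (fun y => 2 * laguerreFun k (2 * y) ^ 2) y) := by
    intro y
    by_cases hy : y ∈ Ioi (0 : ℝ)
    · have h0 : 0 < y := hy
      rw [indicator_of_mem hy, ← ofReal_norm, ← ENNReal.ofReal_pow (norm_nonneg _),
        ← ENNReal.ofReal_mul (by positivity)]
      simp only [waveletHat, indicator_of_mem hy, Complex.norm_real, Real.norm_eq_abs, sq_abs]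
      rw [mul_pow, Real.sq_sqrt (by positivity)]
      congr 1
      field_simp
    · simp [waveletHat, indicator_of_notMem hy]
  have h2 : IntegrableOn (fun y => 2 * laguerreFun k (2 * y) ^ 2) (Ioi 0) := by
    have := (integrableOn_Ioi_comp_mul_left_iff (fun y => laguerreFun k y ^ 2) 0
      (a := 2) (by norm_num)).2 (by simpa using integrableOn_laguerreFun_sq k)
    exact this.const_mul 2
  unfold waveletConst
  simp only [h1]
  rw [← ofReal_integral_eq_lintegral_ofReal ((integrable_indicator_iff measurableSet_Ioi).2 h2)
    (.of_forall fun y => indicator_nonneg (fun _ _ => by positivity) y),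
    integral_indicator measurableSet_Ioi, integral_const_mul,
    integral_comp_mul_left_Ioi (fun y => laguerreFun k y ^ 2) 0 (by norm_num : (0 : ℝ) < 2),
    mul_zero, integral_laguerreFun_sq]
  simp

/-! ### The functions `γ_{a,k}` extend continuously to `[0, +∞]` -/

theorem quasiMeasurePreserving_div_halfLine {c : ℝ} (hc : 0 < c) :
    Measure.QuasiMeasurePreserving (fun v : ℝ => v / c) halfLine halfLine := by
  have h : Measure.QuasiMeasurePreserving (fun v : ℝ => v / c) volume volume := by
    refine ⟨by fun_prop, ?_⟩
    simp only [div_eq_inv_mul]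
    rw [Real.map_volume_mul_left (inv_ne_zero hc.ne')]
    exact Measure.smul_absolutelyContinuous
  exact h.restrict fun v hv => div_pos hv hc

theorem norm_symbol_le (a : Lp ℂ ∞ halfLine) : ∀ᵐ v ∂halfLine, ‖a v‖ ≤ ‖a‖ := by
  have h2 := Lp.norm_def a
  rw [eLpNorm_exponent_top] at h2
  rw [h2]
  filter_upwards [enorm_ae_le_eLpNormEssSup a halfLine] with v hv
  rw [← toReal_enorm]
  refine ENNReal.toReal_mono ?_ hv
  rw [← eLpNorm_exponent_top]
  exact Lp.eLpNorm_ne_top a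

theorem gamma_congr (k : ℕ) {a : Lp ℂ ∞ halfLine} {g : ℝ → ℂ} (h : a =ᵐ[halfLine] g) {ξ : ℝ}
    (hξ : 0 < ξ) :
    gamma k a ξ = ∫ v in Ioi (0 : ℝ), g (v / (2 * ξ)) * ((laguerreFun k v ^ 2 : ℝ) : ℂ) := by
  refine integral_congr_ae ?_
  filter_upwards [(quasiMeasurePreserving_div_halfLine (by positivity : 0 < 2 * ξ)).ae h]
    with v hv
  rw [hv]

/-- The substitution moves `ξ` from `a`, which is only measurable, to the continuous Laguerre
factor, where dominated convergence can use it. -/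
theorem gamma_eq_integral_dilate (k : ℕ) (a : Lp ℂ ∞ halfLine) {ξ : ℝ} (hξ : 0 < ξ) :
    gamma k a ξ = ∫ v in Ioi (0 : ℝ), a v * ((2 * ξ * laguerreFun k (2 * ξ * v) ^ 2 : ℝ) : ℂ) := by
  have h := integral_comp_mul_left_Ioi
    (fun v => a (v / (2 * ξ)) * ((laguerreFun k v ^ 2 : ℝ) : ℂ)) 0
    (by positivity : 0 < 2 * ξ)
  rw [mul_zero] at h
  have h2 : gamma k a ξ = (2 * ξ) • ((2 * ξ)⁻¹ • gamma k a ξ) := by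
    rw [smul_smul, mul_inv_cancel₀ (by positivity), one_smul]
  rw [h2, gamma, ← h, ← integral_smul]
  refine integral_congr_ae (.of_forall fun v => ?_)
  simp only
  rw [mul_div_cancel_left₀ v (by positivity : 2 * ξ ≠ 0), Complex.real_smul]
  push_cast
  ring

theorem continuousAt_gamma (k : ℕ) (a : Lp ℂ ∞ halfLine) {ξ : ℝ} (hξ : 0 < ξ) :
    ContinuousAt (gamma k a) ξ := by
  have hc := continuous_laguerreFun k
  have hev : ∀ᶠ η in 𝓝 ξ, η ∈ Ioo (ξ / 2) (2 * ξ) :=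
    Ioo_mem_nhds (by linarith) (by linarith)
  have h : ContinuousAt (fun η => ∫ v in Ioi (0 : ℝ),
      a v * ((2 * η * laguerreFun k (2 * η * v) ^ 2 : ℝ) : ℂ)) ξ := by
    -- For `η` in `(ξ/2, 2ξ)` the bound follows from `2η ≤ 4ξ` and `exp(-(3/2)ηv) ≤ exp(-(3/4)ξv)`;
    -- the exponent `3/2` comes from squaring the decay rate `3/8` at the point `2ηv`.
    refine continuousAt_of_dominated
      (bound := fun v => ‖a‖ * (4 * ξ * ((9 ^ k) ^ 2 * Real.exp (-(3 / 4 * ξ) * v)))) ?_ ?_ ?_ ?_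
    · refine .of_forall fun η => (Lp.aestronglyMeasurable a).mul ?_
      exact Continuous.aestronglyMeasurable (by fun_prop)
    · filter_upwards [hev] with η hη
      have hη0 : 0 < η := by linarith [hη.1]
      filter_upwards [norm_symbol_le a, ae_restrict_mem measurableSet_Ioi] with v h1 h2
      have hv : 0 < v := h2
      have hl := abs_laguerreFun_le k (y := 2 * η * v) (by positivity)
      rw [norm_mul, Complex.norm_real, Real.norm_eq_abs, abs_mul, abs_pow,
        abs_of_pos (by positivity : 0 < 2 * η)]
      have h3 : |laguerreFun k (2 * η * v)| ^ 2 ≤ (9 ^ k) ^ 2 * Real.exp (-(3 / 4 * ξ) * v) := by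
        calc |laguerreFun k (2 * η * v)| ^ 2
            ≤ (9 ^ k * Real.exp (-(3 / 8) * (2 * η * v))) ^ 2 := by gcongr
          _ = (9 ^ k) ^ 2 * Real.exp (-(3 / 2 * η * v)) := by
            rw [mul_pow, ← Real.exp_nat_mul]
            ring_nf
          _ ≤ _ := by
            gcongr
            nlinarith [mul_pos hv (sub_pos.2 hη.1)]
      have h4 : 2 * η ≤ 4 * ξ := by linarith [hη.2]
      gcongr
    · exact ((((exp_neg_integrableOn_Ioi 0 (by positivity)).const_mul _).const_mul _).const_mul _)
    · refine .of_forall fun v => ?_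
      exact Continuous.continuousAt (by fun_prop)
  refine h.congr ?_
  filter_upwards [lt_mem_nhds hξ] with η hη using (gamma_eq_integral_dilate k a hη).symm

/-- Dominated convergence against the probability density `ℓ_k²`. Both ends are covered at once: `l`
is the filter for `ξ` and `m` the filter followed by the argument `v / (2ξ)` of the symbol, so `ξ →
0` sees the symbol at `+∞` and `ξ → +∞` sees it at `0`. -/
theorem tendsto_gamma (k : ℕ) {a : Lp ℂ ∞ halfLine} {g : ℝ → ℂ} (h : a =ᵐ[halfLine] g)
    {l m : Filter ℝ} [l.IsCountablyGenerated] {c : ℂ} (hl : ∀ᶠ ξ in l, 0 < ξ)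
    (hlm : ∀ v : ℝ, 0 < v → Tendsto (fun ξ => v / (2 * ξ)) l m) (hg : Tendsto g m (𝓝 c)) :
    Tendsto (gamma k a) l (𝓝 c) := by
  have hc := continuous_laguerreFun k
  have h1 : ∫ v in Ioi (0 : ℝ), c * ((laguerreFun k v ^ 2 : ℝ) : ℂ) = c := by
    rw [integral_const_mul, integral_complex_ofReal, integral_laguerreFun_sq]
    simp
  have h2 : Tendsto (fun ξ => ∫ v in Ioi (0 : ℝ), g (v / (2 * ξ)) *
      ((laguerreFun k v ^ 2 : ℝ) : ℂ)) l
      (𝓝 (∫ v in Ioi (0 : ℝ), c * ((laguerreFun k v ^ 2 : ℝ) : ℂ))) := by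
    refine tendsto_integral_filter_of_dominated_convergence
      (fun v => ‖a‖ * laguerreFun k v ^ 2) ?_ ?_ ((integrableOn_laguerreFun_sq k).const_mul _) ?_
    · filter_upwards [hl] with ξ hξ
      have hq := quasiMeasurePreserving_div_halfLine (by positivity : 0 < 2 * ξ)
      refine AEStronglyMeasurable.mul ?_ (Continuous.aestronglyMeasurable (by fun_prop))
      exact ((Lp.aestronglyMeasurable a).congr h).comp_quasiMeasurePreserving hq
    · filter_upwards [hl] with ξ hξ
      have hq := quasiMeasurePreserving_div_halfLine (by positivity : 0 < 2 * ξ)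
      filter_upwards [hq.ae h, hq.ae (norm_symbol_le a)] with v h3 h4
      rw [norm_mul, Complex.norm_real, Real.norm_eq_abs, abs_of_nonneg (sq_nonneg _), ← h3]
      gcongr
    · filter_upwards [ae_restrict_mem measurableSet_Ioi] with v hv
      exact (hg.comp (hlm v hv)).mul_const _
  rw [h1] at h2
  refine h2.congr' ?_
  filter_upwards [hl] with ξ hξ using (gamma_congr k h hξ).symm

theorem tendsto_gamma_zero (k : ℕ) {a : Lp ℂ ∞ halfLine} {g : ℝ → ℂ} (h : a =ᵐ[halfLine] g)
    {c : ℂ} (hg : Tendsto g atTop (𝓝 c)) : Tendsto (gamma k a) (𝓝[>] 0) (𝓝 c) := by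
  refine tendsto_gamma k h self_mem_nhdsWithin (fun v hv => ?_) hg
  have : Tendsto (fun ξ : ℝ => (v / 2) * ξ⁻¹) (𝓝[>] 0) atTop :=
    tendsto_inv_nhdsGT_zero.const_mul_atTop (by positivity)
  refine this.congr fun ξ => ?_
  rw [← div_eq_mul_inv, div_div]

theorem tendsto_gamma_atTop (k : ℕ) {a : Lp ℂ ∞ halfLine} {g : ℝ → ℂ} (h : a =ᵐ[halfLine] g)
    {c : ℂ} (hg : Tendsto g (𝓝[>] 0) (𝓝 c)) : Tendsto (gamma k a) atTop (𝓝 c) := by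
  refine tendsto_gamma k h (eventually_gt_atTop 0) (fun v hv => ?_) hg
  refine tendsto_nhdsWithin_iff.2 ⟨?_, ?_⟩
  · have : Tendsto (fun ξ : ℝ => (v / 2) * ξ⁻¹) atTop (𝓝 ((v / 2) * 0)) :=
      tendsto_inv_atTop_zero.const_mul _
    rw [mul_zero] at this
    refine this.congr fun ξ => ?_
    rw [← div_eq_mul_inv, div_div]
  · filter_upwards [eventually_gt_atTop 0] with ξ hξ
    exact div_pos hv (by positivity)

/-- A continuous function on `(0, +∞)` with limits at both ends extends to `[0, +∞]`. -/
theorem exists_continuousMap_ennreal {f : ℝ → ℂ} {c₀ cInf : ℂ}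
    (hf : ∀ ξ, 0 < ξ → ContinuousAt f ξ) (h0 : Tendsto f (𝓝[>] 0) (𝓝 c₀))
    (hInf : Tendsto f atTop (𝓝 cInf)) :
    ∃ G : C(ℝ≥0∞, ℂ), G 0 = c₀ ∧ G ⊤ = cInf ∧ ∀ ξ, 0 < ξ → G (ENNReal.ofReal ξ) = f ξ := by
  classical
  -- `ENNReal.toReal` sends both `0` and `⊤` to `0`, so both end values have to be put in by hand.
  let G₁ : ℝ≥0∞ → ℂ := Function.update (fun x => f x.toReal) ⊤ cInf
  let G : ℝ≥0∞ → ℂ := Function.update G₁ 0 c₀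
  have hmid : ∀ x : ℝ≥0∞, x ≠ 0 → x ≠ ⊤ → G =ᶠ[𝓝 x] fun x => f x.toReal := fun x hx hx' => by
    filter_upwards [isOpen_ne.mem_nhds hx, isOpen_ne.mem_nhds hx'] with y hy hy'
    simp [G, G₁, Function.update_of_ne hy, Function.update_of_ne hy']
  have hG : Continuous G := continuous_iff_continuousAt.2 fun x => by
    by_cases hx : x = 0
    · subst hx
      refine continuousAt_update_same.2 ?_
      have h1 : Tendsto ENNReal.toReal (𝓝[≠] (0 : ℝ≥0∞)) (𝓝[>] 0) := by
        refine tendsto_nhdsWithin_iff.2 ⟨?_, ?_⟩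
        · exact (ENNReal.tendsto_toReal ENNReal.zero_ne_top).mono_left nhdsWithin_le_nhds
        · filter_upwards [self_mem_nhdsWithin,
            nhdsWithin_le_nhds (isOpen_ne.mem_nhds ENNReal.zero_ne_top)] with y hy hy'
          exact ENNReal.toReal_pos hy hy'
      refine (h0.comp h1).congr' ?_
      filter_upwards [nhdsWithin_le_nhds (isOpen_ne.mem_nhds ENNReal.zero_ne_top)] with y hy
      simp [G₁, Function.update_of_ne hy]
    · by_cases hx' : x = ⊤
      · subst hx'
        have h1 : ContinuousAt G₁ ⊤ := by
          refine continuousAt_update_same.2 (hInf.comp ?_)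
          refine tendsto_atTop.2 fun b => ?_
          filter_upwards [self_mem_nhdsWithin,
            nhdsWithin_le_nhds (lt_mem_nhds (ENNReal.ofReal_lt_top (r := b)))] with y hy hy'
          exact (ENNReal.ofReal_le_iff_le_toReal hy).1 (le_of_lt hy')
        refine h1.congr ?_
        filter_upwards [isOpen_ne.mem_nhds hx] with y hy
        simp [G, Function.update_of_ne hy]
      · refine ContinuousAt.congr ?_ (hmid x hx hx').symm
        exact (hf _ (ENNReal.toReal_pos hx hx')).comp (f := ENNReal.toReal)
          (ENNReal.continuousAt_toReal hx')
  refine ⟨⟨G, hG⟩, by simp [G], by simp [G, G₁], fun ξ hξ => ?_⟩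
  have := (hmid (ENNReal.ofReal ξ) (by simpa using hξ) ENNReal.ofReal_ne_top).eq_of_nhds
  rw [ENNReal.toReal_ofReal hξ.le] at this
  exact this

theorem exists_continuousMap_gamma (k : ℕ) {a : Lp ℂ ∞ halfLine} {g : ℝ → ℂ} {a₀ aInf : ℂ}
    (h : a =ᵐ[halfLine] g) (h0 : Tendsto g (𝓝[>] 0) (𝓝 a₀)) (hInf : Tendsto g atTop (𝓝 aInf)) :
    ∃ G : C(ℝ≥0∞, ℂ), G 0 = aInf ∧ G ⊤ = a₀ ∧
      ∀ ξ, 0 < ξ → G (ENNReal.ofReal ξ) = gamma k a ξ :=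
  exists_continuousMap_ennreal (fun _ => continuousAt_gamma k a) (tendsto_gamma_zero k h hInf)
    (tendsto_gamma_atTop k h h0)

theorem ext_of_ofReal {G H : C(ℝ≥0∞, ℂ)}
    (h : ∀ ξ : ℝ, 0 < ξ → G (ENNReal.ofReal ξ) = H (ENNReal.ofReal ξ)) : G = H := by
  have hd : Dense ({0, ⊤}ᶜ : Set ℝ≥0∞) := by
    refine dense_of_exists_between fun x y hxy => ?_
    obtain ⟨z, hxz, hzy⟩ := exists_between hxy
    refine ⟨z, ?_, hxz, hzy⟩
    simp [(pos_of_gt hxz).ne', (hzy.trans_le le_top).ne]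
  refine DFunLike.coe_injective (Continuous.ext_on hd G.continuous H.continuous fun x hx => ?_)
  simp only [mem_compl_iff, mem_insert_iff, mem_singleton_iff, not_or] at hx
  rw [← ENNReal.ofReal_toReal hx.2]
  exact h _ (ENNReal.toReal_pos hx.1 hx.2)

/-- There is a symbol `a` (the characteristic function of `(0, 1)`) for which the continuous
extension of `γ_{a,k}` is injective on `[0, +∞]`. -/
theorem exists_injective_gamma (k : ℕ) : ∃ a ∈ symbolsWithLimits, ∃ G : C(ℝ≥0∞, ℂ),
    (∀ ξ, 0 < ξ → G (ENNReal.ofReal ξ) = gamma k a ξ) ∧ Function.Injective G := by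
  let g : ℝ → ℂ := (Iio 1).indicator fun _ => 1
  have hg : MemLp g ∞ halfLine := by
    refine memLp_top_of_bound ((measurable_const.indicator measurableSet_Iio).aestronglyMeasurable)
      1 (.of_forall fun v => ?_)
    exact (norm_indicator_le_norm_self _ _).trans (by simp)
  have hae := hg.coeFn_toLp
  have h0 : Tendsto g (𝓝[>] 0) (𝓝 1) := by
    refine tendsto_const_nhds.congr' ?_
    filter_upwards [nhdsWithin_le_nhds (Iio_mem_nhds (zero_lt_one' ℝ))] with v hv
    exact (indicator_of_mem hv (fun _ => (1 : ℂ))).symm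
  have hInf : Tendsto g atTop (𝓝 0) := by
    refine tendsto_const_nhds.congr' ?_
    filter_upwards [eventually_ge_atTop 1] with v hv
    exact (indicator_of_notMem (notMem_Iio.2 hv) (fun _ => (1 : ℂ))).symm
  obtain ⟨G, hG0, hG1, hG⟩ := exists_continuousMap_gamma k hae h0 hInf
  refine ⟨_, ⟨g, 1, 0, hae, h0, hInf⟩, G, hG, ?_⟩
  -- This is the interval `(0, 2x)`, written so that it is empty for `x = 0` and the whole half-line
  -- for `x = ⊤`; one formula for `G` then holds at the end points too.
  let S : ℝ≥0∞ → Set ℝ := fun x => {v | ENNReal.ofReal (v / 2) < x} ∩ Ioi 0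
  have hS : ∀ x, MeasurableSet (S x) := fun x =>
    (measurableSet_lt (by fun_prop) measurable_const).inter measurableSet_Ioi
  have hint : ∀ T ⊆ Ioi (0 : ℝ), IntegrableOn (fun v => laguerreFun k v ^ 2) T := fun T hT =>
    (integrableOn_laguerreFun_sq k).mono_set hT
  have hGS : ∀ x, G x = ((∫ v in S x, laguerreFun k v ^ 2 : ℝ) : ℂ) := fun x => by
    by_cases hx : x = 0
    · rw [hx, hG0]
      simp [S]
    by_cases hx' : x = ⊤
    · rw [hx', hG1]
      have : S ⊤ = Ioi 0 := by simp [S]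
      rw [this, integral_laguerreFun_sq, Complex.ofReal_one]
    have hpos := ENNReal.toReal_pos hx hx'
    obtain ⟨ξ, rfl⟩ : ∃ ξ, x = ENNReal.ofReal ξ := ⟨_, (ENNReal.ofReal_toReal hx').symm⟩
    have hξ : 0 < ξ := by simpa using hx
    have hSξ : S (ENNReal.ofReal ξ) = Iio (2 * ξ) ∩ Ioi 0 := by
      ext v
      simp only [S, mem_inter_iff, mem_ofPred_eq, ENNReal.ofReal_lt_ofReal_iff hξ, mem_Iio,
        div_lt_iff₀ (zero_lt_two' ℝ), mul_comm ξ]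
    rw [hG ξ hξ, gamma_congr k hae hξ, ← integral_complex_ofReal, hSξ,
      ← Measure.restrict_restrict measurableSet_Iio, ← integral_indicator measurableSet_Iio]
    refine integral_congr_ae (.of_forall fun v => ?_)
    by_cases hv : v < 2 * ξ
    · have h1 : v / (2 * ξ) < 1 := (div_lt_one (by positivity)).2 hv
      simp [g, hv, h1]
    · have h1 : ¬ v / (2 * ξ) < 1 := fun h => hv ((div_lt_one (by positivity)).1 h)
      simp [g, hv, h1]
  have hmono : StrictMono fun x => ∫ v in S x, laguerreFun k v ^ 2 := fun x y hxy => by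
    have hsub : S x ⊆ S y := fun v hv => ⟨lt_trans hv.1 hxy, hv.2⟩
    have h1 := setIntegral_union (f := fun v => laguerreFun k v ^ 2) (μ := volume)
      (disjoint_sdiff_right (s := S x) (t := S y))
      ((hS y).diff (hS x)) (hint _ inter_subset_right)
      (hint _ (sdiff_subset.trans inter_subset_right))
    rw [union_sdiff_cancel hsub] at h1
    simp only
    rw [h1, lt_add_iff_pos_right, setIntegral_pos_iff_support_of_nonneg_ae
      (.of_forall fun v => sq_nonneg _) (hint _ (sdiff_subset.trans inter_subset_right))]
    -- Two finite points are inserted because `y` may be `⊤`. The interval `(2p, 2q)` lies in `S y \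
    -- S x`, and removing the finitely many zeros of `ℓ_k` leaves positive measure.
    obtain ⟨p, hxp, hpy⟩ := ENNReal.lt_iff_exists_nnreal_btwn.1 hxy
    obtain ⟨q, hpq, hqy⟩ := ENNReal.lt_iff_exists_nnreal_btwn.1 hpy
    have hpq' : (p : ℝ) < q := by exact_mod_cast hpq
    have hp0 : (0 : ℝ) ≤ p := p.2
    have h2 : Ioo (2 * p : ℝ) (2 * q) \ {v | laguerreFun k v = 0} ⊆
        Function.support (fun v => laguerreFun k v ^ 2) ∩ (S y \ S x) := by
      rintro v ⟨⟨hv1, hv2⟩, hv3⟩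
      refine ⟨pow_ne_zero 2 hv3, ⟨?_, ?_⟩, fun h => ?_⟩
      · refine lt_trans ?_ hqy
        rw [← ENNReal.ofReal_coe_nnreal]
        exact (ENNReal.ofReal_lt_ofReal_iff (by linarith)).2 (by linarith)
      · exact lt_of_le_of_lt (by positivity) hv1
      · have h3 := lt_trans h.1 hxp
        rw [← ENNReal.ofReal_coe_nnreal] at h3
        linarith [(ENNReal.ofReal_lt_ofReal_iff').1 h3 |>.1]
    refine lt_of_lt_of_le ?_ (measure_mono h2)
    rw [measure_sdiff_null ((finite_laguerreFun_eq_zero k).measure_zero _), Real.volume_Ioo]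
    simpa using hpq'
  intro x y hxy
  rw [hGS, hGS] at hxy
  exact hmono.injective (Complex.ofReal_injective hxy)

/-! ### The quadratic forms of Calderón–Toeplitz operators -/

/-- The powers of `v` cancel: `v⁻² · v · 2vξ ℓ_k(2vξ)² = 2ξ ℓ_k(2ξv)²`, the density in the dilated
form of `γ_{a,k}`. -/
theorem integral_scaleMeasure_waveletHat (k : ℕ) (a : Lp ℂ ∞ halfLine) {ξ : ℝ} (hξ : 0 < ξ) :
    ∫ v, a v * ((v * ‖waveletHat k (v * ξ)‖ ^ 2 : ℝ) : ℂ) ∂scaleMeasure = gamma k a ξ := by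
  have hd : Measurable fun v : ℝ => ENNReal.ofReal (v ^ 2)⁻¹ := by fun_prop
  rw [gamma_eq_integral_dilate k a hξ, scaleMeasure,
    integral_withDensity_eq_integral_toReal_smul hd (.of_forall fun _ => ENNReal.ofReal_lt_top)]
  refine setIntegral_congr_fun measurableSet_Ioi fun v hv => ?_
  have hv0 : 0 < v := hv
  have h1 : v * ξ ∈ Ioi (0 : ℝ) := mul_pos hv0 hξ
  simp only [waveletHat, indicator_of_mem h1, Complex.norm_real, Real.norm_eq_abs, sq_abs]
  rw [ENNReal.toReal_ofReal (by positivity), mul_pow, Real.sq_sqrt (by positivity),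
    Complex.real_smul, mul_left_comm, ← Complex.ofReal_mul, show 2 * (v * ξ) = 2 * ξ * v by ring]
  congr 2
  field_simp

theorem enorm_sq_waveletHat {k : ℕ} {v : ℝ} (hv : 0 < v) (ξ : ℝ) (z : ℂ) :
    ‖v * ‖waveletHat k (v * ξ)‖ ^ 2 * ‖z‖ ^ 2‖ₑ =
      ENNReal.ofReal v * ‖waveletHat k (v * ξ)‖ₑ ^ 2 * ‖z‖ₑ ^ 2 := by
  rw [enorm_mul, enorm_mul, enorm_pow, enorm_pow, enorm_norm, enorm_norm,
    Real.enorm_eq_ofReal hv.le]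

theorem integral_waveletTransform_slice (k : ℕ) (f : Lp ℂ 2 (volume : Measure ℝ)) {v : ℝ}
    (hv : 0 < v) :
    ∫ u, ‖waveletTransform k f (u, v)‖ ^ 2 =
      ∫ ξ : ℝ, v * ‖waveletHat k (v * ξ)‖ ^ 2 *
        ‖(𝓕 f : Lp ℂ 2 (volume : Measure ℝ)) ξ‖ ^ 2 := by
  have hWv : Measurable fun u => waveletTransform k f (u, v) :=
    (measurable_waveletTransform k f).measurable.comp (by fun_prop)
  have hψ := measurable_waveletHat k
  have hF := (Lp.stronglyMeasurable (𝓕 f : Lp ℂ 2 (volume : Measure ℝ))).measurable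
  rw [integral_eq_lintegral_of_nonneg_ae (.of_forall fun _ => by positivity)
      (hWv.norm.pow_const 2).aestronglyMeasurable,
    integral_eq_lintegral_of_nonneg_ae (.of_forall fun _ => by positivity)
      (Measurable.aestronglyMeasurable (by fun_prop))]
  congr 1
  have h := lintegral_waveletTransform_slice k f hv
  simp only [← enorm_sq_waveletHat hv] at h
  refine Eq.trans ?_ (h.trans ?_)
  · refine lintegral_congr fun u => ?_
    rw [ENNReal.ofReal_pow (norm_nonneg _), ofReal_norm]
  · refine lintegral_congr fun ξ => ?_
    rw [Real.enorm_eq_ofReal (by positivity)]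

/-- Justifies Fubini for complex symbols. Plancherel on each slice shows that the total integral is
the squared norm of `W_k f`, which is finite. -/
theorem integrable_waveletHat_mul_fourier (k : ℕ) {f : Lp ℂ 2 (volume : Measure ℝ)}
    (hf : f ∈ hardySpace) :
    Integrable (fun p : ℝ × ℝ => p.1 * ‖waveletHat k (p.1 * p.2)‖ ^ 2 *
      ‖(𝓕 f : Lp ℂ 2 (volume : Measure ℝ)) p.2‖ ^ 2) (scaleMeasure.prod volume) := by
  have hψ := measurable_waveletHat k
  have hF := (Lp.stronglyMeasurable (𝓕 f : Lp ℂ 2 (volume : Measure ℝ))).measurable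
  have hm : Measurable fun p : ℝ × ℝ => p.1 * ‖waveletHat k (p.1 * p.2)‖ ^ 2 *
      ‖(𝓕 f : Lp ℂ 2 (volume : Measure ℝ)) p.2‖ ^ 2 := by fun_prop
  refine ⟨hm.aestronglyMeasurable, ?_⟩
  have hW := lintegral_waveletTransform k hf
  have hmW : Measurable fun ζ : ℝ × ℝ => ‖waveletTransform k f ζ‖ₑ ^ 2 :=
    (measurable_waveletTransform k f).measurable.enorm.pow_const 2
  unfold affineMeasure at hW
  rw [lintegral_prod_symm' _ hmW] at hW
  rw [HasFiniteIntegral, lintegral_prod _ hm.enorm.aemeasurable]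
  have h1 : ∫⁻ v, ∫⁻ ξ : ℝ, ‖v * ‖waveletHat k (v * ξ)‖ ^ 2 *
      ‖(𝓕 f : Lp ℂ 2 (volume : Measure ℝ)) ξ‖ ^ 2‖ₑ ∂volume ∂scaleMeasure =
      ∫⁻ v, ∫⁻ u, ‖waveletTransform k f (u, v)‖ₑ ^ 2 ∂volume ∂scaleMeasure := by
    refine lintegral_congr_ae (ae_scaleMeasure fun v hv => ?_)
    simp only [enorm_sq_waveletHat hv]
    exact (lintegral_waveletTransform_slice k f hv).symm
  rw [h1, hW, ← eLpNorm_two_sq]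
  exact ENNReal.mul_lt_top (waveletConst_ne_top k).lt_top
    (ENNReal.pow_lt_top (Lp.eLpNorm_lt_top f))

/-- Since the symbol is constant on each slice `v = const`, Plancherel in `u` applies under it;
after exchanging the integrals the `v`-integral is `γ_{a,k}(ξ)`. Values of `G` on the negative
half-line do not matter, because `𝓕 f` vanishes there. -/
theorem integral_symbol_mul_waveletTransform (k : ℕ) (a : Lp ℂ ∞ halfLine) {G : ℝ → ℂ}
    (hG : ∀ ξ, 0 < ξ → G ξ = gamma k a ξ) {f : Lp ℂ 2 (volume : Measure ℝ)}
    (hf : f ∈ hardySpace) :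
    ∫ ζ, a ζ.2 * ((‖waveletTransform k f ζ‖ ^ 2 : ℝ) : ℂ) ∂affineMeasure =
      ∫ ξ, G ξ * ((‖(𝓕 f : Lp ℂ 2 (volume : Measure ℝ)) ξ‖ ^ 2 : ℝ) : ℂ) := by
  have ha := (Lp.stronglyMeasurable a).measurable
  have hbound : ∀ᵐ v ∂scaleMeasure, ‖a v‖ ≤ ‖a‖ :=
    (withDensity_absolutelyContinuous _ _).ae_le (norm_symbol_le a)
  have hint : Integrable (fun ζ : ℝ × ℝ => a ζ.2 * ((‖waveletTransform k f ζ‖ ^ 2 : ℝ) : ℂ))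
      affineMeasure := by
    have h1 := (memLp_two_iff_integrable_sq_norm
      (measurable_waveletTransform k f).aestronglyMeasurable).1 (memLp_waveletTransform k hf)
    refine (h1.ofReal (𝕜 := ℂ)).bdd_mul (c := ‖a‖)
      (Measurable.aestronglyMeasurable (by fun_prop)) ?_
    exact Measure.quasiMeasurePreserving_snd.ae hbound
  have hint2 : Integrable (Function.uncurry fun v ξ : ℝ => a v * ((v * ‖waveletHat k (v * ξ)‖ ^ 2 *
      ‖(𝓕 f : Lp ℂ 2 (volume : Measure ℝ)) ξ‖ ^ 2 : ℝ) : ℂ)) (scaleMeasure.prod volume) := by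
    refine ((integrable_waveletHat_mul_fourier k hf).ofReal (𝕜 := ℂ)).bdd_mul (c := ‖a‖)
      (f := fun p : ℝ × ℝ => a p.1) (Measurable.aestronglyMeasurable (by fun_prop)) ?_
    exact Measure.quasiMeasurePreserving_fst.ae hbound
  unfold affineMeasure at hint ⊢
  rw [integral_prod_symm _ hint]
  have h1 : ∫ v, ∫ u, a v * ((‖waveletTransform k f (u, v)‖ ^ 2 : ℝ) : ℂ) ∂volume ∂scaleMeasure =
      ∫ v, ∫ ξ, a v * ((v * ‖waveletHat k (v * ξ)‖ ^ 2 *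
        ‖(𝓕 f : Lp ℂ 2 (volume : Measure ℝ)) ξ‖ ^ 2 : ℝ) : ℂ) ∂volume ∂scaleMeasure := by
    refine integral_congr_ae (ae_scaleMeasure fun v hv => ?_)
    simp only
    rw [integral_const_mul, integral_const_mul, integral_complex_ofReal, integral_complex_ofReal,
      integral_waveletTransform_slice k f hv]
  rw [h1, integral_integral_swap hint2]
  refine integral_congr_ae ?_
  have hne : ∀ᵐ ξ : ℝ, ξ ≠ 0 := by simp [ae_iff]
  filter_upwards [hf, hne] with ξ h2 h3
  rcases lt_or_gt_of_ne h3 with h4 | h4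
  · simp [h2 h4]
  · rw [hG ξ h4, ← integral_scaleMeasure_waveletHat k a h4, ← integral_mul_const]
    refine integral_congr_ae (.of_forall fun v => ?_)
    simp only
    push_cast
    ring

/-! ### Diagonalization of the Calderón–Toeplitz operators -/

/-- The wavelet transform as a linear isometry of `H₂⁺(ℝ)` into `L₂(G, dν)`. -/
def waveletIsometry (k : ℕ) : hardySpace →ₗᵢ[ℂ] Lp ℂ 2 affineMeasure where
  toFun f := (memLp_waveletTransform k f.2).toLp _
  map_add' f g := by
    refine Lp.ext ?_
    filter_upwards [(memLp_waveletTransform k f.2).coeFn_toLp,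
      (memLp_waveletTransform k g.2).coeFn_toLp, (memLp_waveletTransform k (f + g).2).coeFn_toLp,
      Lp.coeFn_add ((memLp_waveletTransform k f.2).toLp _) ((memLp_waveletTransform k g.2).toLp _),
      ae_affineMeasure (p := fun ζ => waveletTransform k
        (f.1 + g.1 : Lp ℂ 2 (volume : Measure ℝ)) ζ =
        waveletTransform k f.1 ζ + waveletTransform k g.1 ζ)
        fun u v hv => waveletTransform_add k f.1 g.1 u hv] with ζ h1 h2 h3 h4 h5
    rw [h4, Pi.add_apply, h1, h2, h3]
    exact h5
  map_smul' c f := by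
    refine Lp.ext ?_
    filter_upwards [(memLp_waveletTransform k f.2).coeFn_toLp,
      (memLp_waveletTransform k (c • f).2).coeFn_toLp,
      Lp.coeFn_smul c ((memLp_waveletTransform k f.2).toLp _)] with ζ h1 h2 h3
    rw [RingHom.id_apply, h3, Pi.smul_apply, h1, h2]
    exact waveletTransform_smul k c f.1 ζ.1 ζ.2
  norm_map' f := by
    have h := lintegral_waveletTransform k f.2
    rw [← eLpNorm_two_sq, ← eLpNorm_two_sq, waveletConst_eq_one, one_mul] at h
    have h' := congrArg ENNReal.toReal h
    rw [ENNReal.toReal_pow, ENNReal.toReal_pow, ← Lp.norm_def] at h'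
    change ‖(memLp_waveletTransform k f.2).toLp _‖ = ‖f.1‖
    rw [Lp.norm_toLp]
    exact (pow_left_inj₀ ENNReal.toReal_nonneg (norm_nonneg _) two_ne_zero).1 h'

theorem waveletIsometry_ae (k : ℕ) (f : hardySpace) :
    waveletIsometry k f =ᵐ[affineMeasure] waveletTransform k f.1 :=
  (memLp_waveletTransform k f.2).coeFn_toLp

/-- The wavelet transform as a unitary operator of `H₂⁺(ℝ)` onto `A^{(k)}`. -/
def waveletEquiv (k : ℕ) : hardySpace ≃ₗᵢ[ℂ] waveletSubspace k :=
  LinearIsometryEquiv.ofSurjective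
    { toLinearMap := (waveletIsometry k).toLinearMap.codRestrict (waveletSubspace k)
        fun f => ⟨f.1, f.2, waveletIsometry_ae k f⟩
      norm_map' := (waveletIsometry k).norm_map } (by
    rintro ⟨F, f, hf, hF⟩
    exact ⟨⟨f, hf⟩, Subtype.ext (Lp.ext ((waveletIsometry_ae k ⟨f, hf⟩).trans hF.symm))⟩)

theorem waveletEquiv_ae (k : ℕ) (f : hardySpace) :
    (waveletEquiv k f).1 =ᵐ[affineMeasure] waveletTransform k f.1 :=
  waveletIsometry_ae k f

/-- The isometry `W_k f ↦ 𝓕 f` of `A^{(k)}` onto the functions in `L₂(ℝ)` that vanish on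
`(-∞, 0)`. -/
def fourierIsometry (k : ℕ) : waveletSubspace k →ₗᵢ[ℂ] Lp ℂ 2 (volume : Measure ℝ) :=
  (Lp.fourierTransformₗᵢ ℝ ℂ).toLinearIsometry.comp
    (hardySpace.subtypeₗᵢ.comp (waveletEquiv k).symm.toLinearIsometry)

theorem fourierIsometry_waveletEquiv (k : ℕ) (f : hardySpace) :
    fourierIsometry k (waveletEquiv k f) = 𝓕 f.1 := by
  change 𝓕 ((waveletEquiv k).symm (waveletEquiv k f)).1 = _
  rw [LinearIsometryEquiv.symm_apply_apply]

theorem fourierIsometry_ae_eq_zero (k : ℕ) (F : waveletSubspace k) :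
    ∀ᵐ ξ : ℝ, ξ < 0 → fourierIsometry k F ξ = 0 :=
  ((waveletEquiv k).symm F).2

theorem exists_fourierIsometry_eq (k : ℕ) {h : Lp ℂ 2 (volume : Measure ℝ)}
    (hh : ∀ᵐ ξ : ℝ, ξ < 0 → h ξ = 0) : ∃ F, fourierIsometry k F = h := by
  have h1 : (𝓕 (𝓕⁻ h : Lp ℂ 2 (volume : Measure ℝ)) : Lp ℂ 2 (volume : Measure ℝ)) = h :=
    FourierTransform.fourier_fourierInv_eq h
  refine ⟨waveletEquiv k ⟨𝓕⁻ h, ?_⟩, ?_⟩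
  · change ∀ᵐ ξ : ℝ, ξ < 0 → (𝓕 (𝓕⁻ h : Lp ℂ 2 (volume : Measure ℝ)) :
      Lp ℂ 2 (volume : Measure ℝ)) ξ = 0
    rwa [h1]
  · rw [fourierIsometry_waveletEquiv, h1]

/-! ### Multiplication operators on the Fourier side -/

theorem memLp_comp_ofReal (G : C(ℝ≥0∞, ℂ)) :
    MemLp (fun ξ : ℝ => G (ENNReal.ofReal ξ)) ∞ volume :=
  memLp_top_of_bound (G.continuous.comp ENNReal.continuous_ofReal).aestronglyMeasurable ‖G‖
    (.of_forall fun _ => G.norm_coe_le_norm _)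

/-- Multiplication by the function `ξ ↦ G ξ` on `L₂(ℝ)`, where `G` is extended to the negative
half-line by its value at `0`. -/
def multiplier (G : C(ℝ≥0∞, ℂ)) :
    Lp ℂ 2 (volume : Measure ℝ) →L[ℂ] Lp ℂ 2 (volume : Measure ℝ) :=
  (ContinuousLinearMap.mul ℂ ℂ).holderL volume ∞ 2 2 ((memLp_comp_ofReal G).toLp _)

theorem multiplier_ae (G : C(ℝ≥0∞, ℂ)) (h : Lp ℂ 2 (volume : Measure ℝ)) :
    multiplier G h =ᵐ[volume] fun ξ => G (ENNReal.ofReal ξ) * h ξ := by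
  filter_upwards [(ContinuousLinearMap.mul ℂ ℂ).coeFn_holder (r := 2)
    ((memLp_comp_ofReal G).toLp _) h, (memLp_comp_ofReal G).coeFn_toLp] with ξ h1 h2
  rw [← h2]
  exact h1

theorem mulOperator_ae (a : Lp ℂ ∞ halfLine) (F : Lp ℂ 2 affineMeasure) :
    mulOperator a F =ᵐ[affineMeasure] fun ζ => a ζ.2 * F ζ := by
  filter_upwards [(ContinuousLinearMap.mul ℂ ℂ).coeFn_holder (r := 2)
    ((memLp_symbol a).toLp _) F, (memLp_symbol a).coeFn_toLp] with ξ h1 h2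
  rw [← h2]
  exact h1

theorem multiplier_mul (G H : C(ℝ≥0∞, ℂ)) (h : Lp ℂ 2 (volume : Measure ℝ)) :
    multiplier (G * H) h = multiplier G (multiplier H h) := by
  refine Lp.ext ?_
  filter_upwards [multiplier_ae (G * H) h, multiplier_ae H h,
    multiplier_ae G (multiplier H h)] with ξ h1 h2 h3
  rw [h1, h3, h2, ContinuousMap.mul_apply, mul_assoc]

theorem multiplier_add (G H : C(ℝ≥0∞, ℂ)) (h : Lp ℂ 2 (volume : Measure ℝ)) :
    multiplier (G + H) h = multiplier G h + multiplier H h := by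
  refine Lp.ext ?_
  filter_upwards [multiplier_ae (G + H) h, multiplier_ae H h, multiplier_ae G h,
    Lp.coeFn_add (multiplier G h) (multiplier H h)] with ξ h1 h2 h3 h4
  rw [h1, h4, Pi.add_apply, h2, h3, ContinuousMap.add_apply, add_mul]

theorem multiplier_algebraMap (c : ℂ) (h : Lp ℂ 2 (volume : Measure ℝ)) :
    multiplier (algebraMap ℂ C(ℝ≥0∞, ℂ) c) h = c • h := by
  refine Lp.ext ?_
  filter_upwards [multiplier_ae (algebraMap ℂ C(ℝ≥0∞, ℂ) c) h, Lp.coeFn_smul c h] with ξ h1 h2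
  rw [h1, h2]
  simp

theorem inner_multiplier_star (G : C(ℝ≥0∞, ℂ)) (g h : Lp ℂ 2 (volume : Measure ℝ)) :
    inner ℂ (multiplier (star G) g) h = inner ℂ g (multiplier G h) := by
  rw [L2.inner_def, L2.inner_def]
  refine integral_congr_ae ?_
  filter_upwards [multiplier_ae (star G) g, multiplier_ae G h] with ξ h1 h2
  rw [h1, h2]
  simp only [RCLike.inner_apply, map_mul, ContinuousMap.star_apply, RCLike.star_def,
    Complex.conj_conj]
  ring

/-- The operator on `A^{(k)}` that corresponds to the multiplication by `G` under
`fourierIsometry k`. -/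
def diagonalOperator (k : ℕ) (G : C(ℝ≥0∞, ℂ)) : waveletSubspace k →L[ℂ] waveletSubspace k :=
  ContinuousLinearMap.adjoint (fourierIsometry k).toContinuousLinearMap ∘L multiplier G ∘L
    (fourierIsometry k).toContinuousLinearMap

theorem inner_diagonalOperator (k : ℕ) (G : C(ℝ≥0∞, ℂ)) (E F : waveletSubspace k) :
    inner ℂ E (diagonalOperator k G F) =
      inner ℂ (fourierIsometry k E) (multiplier G (fourierIsometry k F)) := by
  rw [diagonalOperator, ContinuousLinearMap.comp_apply, ContinuousLinearMap.adjoint_inner_right]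
  rfl

/-- The isometry is not onto `L₂(ℝ)`, but multiplication preserves vanishing on the negative
half-line, hence its range; so its adjoint loses nothing here. This intertwining reduces the
algebraic identities for `diagonalOperator` to those for `multiplier`. -/
theorem fourierIsometry_diagonalOperator (k : ℕ) (G : C(ℝ≥0∞, ℂ)) (F : waveletSubspace k) :
    fourierIsometry k (diagonalOperator k G F) = multiplier G (fourierIsometry k F) := by
  obtain ⟨E, hE⟩ := exists_fourierIsometry_eq k (h := multiplier G (fourierIsometry k F)) (by
    filter_upwards [multiplier_ae G (fourierIsometry k F), fourierIsometry_ae_eq_zero k F]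
      with ξ h1 h2 h3
    rw [h1, h2 h3, mul_zero])
  rw [← hE]
  congr 1
  refine ext_inner_left ℂ fun D => ?_
  rw [inner_diagonalOperator, ← hE, LinearIsometry.inner_map_map]

theorem toeplitz_eq_diagonalOperator (k : ℕ) (a : Lp ℂ ∞ halfLine) {G : C(ℝ≥0∞, ℂ)}
    (hG : ∀ ξ, 0 < ξ → G (ENNReal.ofReal ξ) = gamma k a ξ) :
    toeplitz k a = diagonalOperator k G := by
  -- By complex polarization it suffices to compare the quadratic forms.
  refine ContinuousLinearMap.coe_injective ((ext_inner_map _ _).1 fun F => ?_)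
  rw [← inner_conj_symm, ← inner_conj_symm _ F]
  congr 1
  obtain ⟨f, rfl⟩ := (waveletEquiv k).surjective F
  change inner ℂ _ (toeplitz k a _) = inner ℂ _ (diagonalOperator k G _)
  -- The projection drops out because the other vector already lies in `A^{(k)}`.
  have h1 : inner ℂ (waveletEquiv k f) (toeplitz k a (waveletEquiv k f)) =
      inner ℂ (waveletEquiv k f).1 (mulOperator a (waveletEquiv k f).1) :=
    Submodule.inner_orthogonalProjectionOnto_eq_of_mem_left _ _
  rw [h1, inner_diagonalOperator, fourierIsometry_waveletEquiv, L2.inner_def, L2.inner_def]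
  have h2 : ∀ z w : ℂ, inner ℂ z (w * z) = w * ((‖z‖ ^ 2 : ℝ) : ℂ) := fun z w => by
    rw [RCLike.inner_apply, mul_assoc, Complex.mul_conj, Complex.normSq_eq_norm_sq]
  refine Eq.trans ?_ ((integral_symbol_mul_waveletTransform k a hG f.2).trans ?_)
  · refine integral_congr_ae ?_
    filter_upwards [mulOperator_ae a (waveletEquiv k f).1, waveletEquiv_ae k f] with ζ h3 h4
    rw [h3, h2, h4]
  · refine integral_congr_ae ?_
    filter_upwards [multiplier_ae G (𝓕 f.1)] with ξ h3
    rw [h3, h2]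

/-- The operators `diagonalOperator k G` depend on `G` as a *-homomorphism. -/
def diagonalHom (k : ℕ) : C(ℝ≥0∞, ℂ) →⋆ₐ[ℂ] (waveletSubspace k →L[ℂ] waveletSubspace k) where
  toFun := diagonalOperator k
  map_one' := by
    ext1 F
    refine (fourierIsometry k).injective ?_
    rw [fourierIsometry_diagonalOperator, ← map_one (algebraMap ℂ C(ℝ≥0∞, ℂ)),
      multiplier_algebraMap, one_smul]
    rfl
  map_mul' G H := by
    ext1 F
    refine (fourierIsometry k).injective ?_
    rw [mul_apply_eq_comp]
    simp only [fourierIsometry_diagonalOperator, multiplier_mul]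
  map_zero' := by
    ext1 F
    refine (fourierIsometry k).injective ?_
    rw [fourierIsometry_diagonalOperator, ← map_zero (algebraMap ℂ C(ℝ≥0∞, ℂ)),
      multiplier_algebraMap, zero_smul, zero_apply, map_zero]
  map_add' G H := by
    ext1 F
    refine (fourierIsometry k).injective ?_
    rw [add_apply, map_add]
    simp only [fourierIsometry_diagonalOperator, multiplier_add]
  commutes' c := by
    ext1 F
    refine (fourierIsometry k).injective ?_
    rw [fourierIsometry_diagonalOperator, multiplier_algebraMap,
      ContinuousLinearMap.algebraMap_apply, map_smul]
  map_star' G := by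
    rw [ContinuousLinearMap.star_eq_adjoint, ContinuousLinearMap.eq_adjoint_iff]
    intro E F
    rw [inner_diagonalOperator, ← inner_multiplier_star, ← fourierIsometry_diagonalOperator,
      LinearIsometry.inner_map_map]

theorem diagonalHom_apply (k : ℕ) (G : C(ℝ≥0∞, ℂ)) : diagonalHom k G = diagonalOperator k G := rfl

/-- Testing on `e^{-ξ} χ_(0,∞)`, which lies in the range of `fourierIsometry k` and has no zero on
`(0, ∞)`: if the product with `G` is zero, then `G` vanishes almost everywhere on `(0, ∞)`, and by
continuity and density everywhere. -/
theorem diagonalHom_injective (k : ℕ) : Function.Injective (diagonalHom k) := by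
  refine (injective_iff_map_eq_zero _).2 fun G hG => ?_
  have hm : MemLp ((Ioi (0 : ℝ)).indicator fun ξ => (Real.exp (-ξ) : ℂ)) 2 volume := by
    have hs : Measurable ((Ioi (0 : ℝ)).indicator fun ξ => (Real.exp (-ξ) : ℂ)) :=
      Measurable.indicator (by fun_prop) measurableSet_Ioi
    rw [memLp_two_iff_integrable_sq_norm hs.aestronglyMeasurable]
    have h1 : IntegrableOn (fun ξ : ℝ => Real.exp (-2 * ξ)) (Ioi 0) :=
      exp_neg_integrableOn_Ioi 0 two_pos
    refine ((integrable_indicator_iff measurableSet_Ioi).2 h1).congr (.of_forall fun ξ => ?_)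
    by_cases hξ : ξ ∈ Ioi (0 : ℝ)
    · simp only [indicator_of_mem hξ, Complex.norm_real, Real.norm_eq_abs, Real.abs_exp,
        ← Real.exp_nat_mul]
      congr 1
      push_cast
      ring
    · simp [indicator_of_notMem hξ]
  obtain ⟨F, hF⟩ := exists_fourierIsometry_eq k (h := hm.toLp _) (by
    filter_upwards [hm.coeFn_toLp] with ξ h1 h2
    rw [h1, indicator_of_notMem (notMem_Ioi.2 h2.le)])
  have h0 := fourierIsometry_diagonalOperator k G F
  rw [← diagonalHom_apply, hG, zero_apply, map_zero, hF] at h0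
  have h1 : (fun ξ => G (ENNReal.ofReal ξ)) =ᵐ[volume.restrict (Ioi 0)] fun _ => 0 := by
    refine (ae_restrict_iff' measurableSet_Ioi).2 ?_
    filter_upwards [multiplier_ae G (hm.toLp _), hm.coeFn_toLp,
      Lp.coeFn_zero ℂ 2 (volume : Measure ℝ)] with ξ h2 h3 h4 hξ
    rw [← h0, h4, h3, indicator_of_mem hξ] at h2
    exact (mul_eq_zero.1 h2.symm).resolve_right
      (Complex.ofReal_ne_zero.2 (Real.exp_pos _).ne')
  have h2 := Measure.eqOn_open_of_ae_eq h1 isOpen_Ioi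
    (G.continuous.comp ENNReal.continuous_ofReal).continuousOn continuousOn_const
  exact ext_of_ofReal fun ξ hξ => h2 hξ

/-! ### The algebra generated by the Calderón–Toeplitz operators -/

/-- Stone–Weierstrass: one injective function separates all points. -/
theorem topologicalClosure_adjoin_singleton_eq_top {X : Type*} [TopologicalSpace X]
    [CompactSpace X] {G : C(X, ℂ)} (hG : Function.Injective G) :
    (StarAlgebra.adjoin ℂ {G}).topologicalClosure = ⊤ := by
  refine ContinuousMap.starSubalgebra_topologicalClosure_eq_top_of_separatesPoints _ ?_
  intro x y hxy
  exact ⟨G, ⟨G, StarAlgebra.subset_adjoin ℂ _ rfl, rfl⟩, hG.ne hxy⟩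

theorem isClosed_generatedCStarAlgebra {A : Type*} [CStarAlgebra A] (X : Set A) :
    IsClosed (generatedCStarAlgebra X : Set A) :=
  StarSubalgebra.isClosed_topologicalClosure _

theorem generatedCStarAlgebra_le {A : Type*} [CStarAlgebra A] {X : Set A}
    {S : StarSubalgebra ℂ A} (hX : X ⊆ S) (hS : IsClosed (S : Set A)) :
    generatedCStarAlgebra X ≤ S :=
  StarSubalgebra.topologicalClosure_minimal (StarAlgebra.adjoin_le hX) hS

/-- Injective *-homomorphisms of C*-algebras are isometric; in particular the range is closed. -/
theorem isometry_diagonalHom (k : ℕ) : Isometry (diagonalHom k) :=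
  NonUnitalStarAlgHom.isometry (diagonalHom k) (diagonalHom_injective k)

/-- The preimage of the Toeplitz algebra is a closed *-subalgebra of `C[0, +∞]` containing an
injective `γ_{a,k}`, hence everything. Conversely the range is closed and contains all generators.
-/
theorem range_diagonalHom (k : ℕ) :
    (diagonalHom k).range = toeplitzAlgebra k symbolsWithLimits := by
  refine le_antisymm ?_ ?_
  · obtain ⟨a, ha, G, hG, hinj⟩ := exists_injective_gamma k
    rintro _ ⟨H, rfl⟩
    have hH : H ∈ (StarAlgebra.adjoin ℂ {G}).topologicalClosure := by
      rw [topologicalClosure_adjoin_singleton_eq_top hinj]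
      exact StarSubalgebra.mem_top
    have hle : StarAlgebra.adjoin ℂ {G} ≤
        (toeplitzAlgebra k symbolsWithLimits).comap (diagonalHom k) := by
      refine StarAlgebra.adjoin_le ?_
      rintro H' rfl
      change diagonalOperator k H' ∈ toeplitzAlgebra k symbolsWithLimits
      rw [← toeplitz_eq_diagonalOperator k a hG]
      exact toeplitz_mem k ha
    have hcl : IsClosed (toeplitzAlgebra k symbolsWithLimits :
        Set (waveletSubspace k →L[ℂ] waveletSubspace k)) :=
      isClosed_generatedCStarAlgebra _
    exact StarSubalgebra.topologicalClosure_minimal hle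
      (hcl.preimage (isometry_diagonalHom k).continuous) hH
  · refine generatedCStarAlgebra_le ?_
      (isometry_diagonalHom k).isClosedEmbedding.isClosed_range
    rintro _ ⟨a, ⟨g, a₀, aInf, h, h0, hInf⟩, rfl⟩
    obtain ⟨G, -, -, hG⟩ := exists_continuousMap_gamma k h h0 hInf
    exact ⟨G, (toeplitz_eq_diagonalOperator k a hG).symm⟩

/-- The *-isomorphism `C[0, +∞] ≃ 𝒯_k(L_∞^{{0,+∞}}(ℝ_+))`. -/
def diagonalEquiv (k : ℕ) : C(ℝ≥0∞, ℂ) ≃⋆ₐ[ℂ] toeplitzAlgebra k symbolsWithLimits :=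
  StarAlgEquiv.ofBijective ((diagonalHom k).codRestrict (toeplitzAlgebra k symbolsWithLimits)
    fun G => range_diagonalHom k ▸ ⟨G, rfl⟩) (by
      refine ⟨(StarAlgHom.injective_codRestrict _ _ _).2 (diagonalHom_injective k), ?_⟩
      rintro ⟨T, hT⟩
      rw [← range_diagonalHom k] at hT
      obtain ⟨G, rfl⟩ := hT
      exact ⟨G, rfl⟩)


theorem isometry_diagonalEquiv (k : ℕ) : Isometry (diagonalEquiv k) :=
  fun G H => isometry_diagonalHom k G H

theorem toeplitz_eq_diagonalEquiv (k : ℕ) {a : Lp ℂ ∞ halfLine} (ha : a ∈ symbolsWithLimits)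
    {G : C(ℝ≥0∞, ℂ)} (hG : ∀ ξ, 0 < ξ → G (ENNReal.ofReal ξ) = gamma k a ξ) :
    (⟨toeplitz k a, toeplitz_mem k ha⟩ : toeplitzAlgebra k symbolsWithLimits) =
      diagonalEquiv k G :=
  Subtype.ext (toeplitz_eq_diagonalOperator k a hG)

/-! ### Uniqueness of the isomorphism -/

/-- The composite `τ ∘ e` is a continuous *-endomorphism of `C(X)`. The set where it agrees with the
identity is a closed *-subalgebra containing the topological generator `G`, so it is everything. -/
theorem eq_symm_of_apply_injective {X A : Type*} [TopologicalSpace X] [CompactSpace X]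
    [Semiring A] [Algebra ℂ A] [Star A] (e : C(X, ℂ) ≃⋆ₐ[ℂ] A) (τ : A ≃⋆ₐ[ℂ] C(X, ℂ))
    (hτ : Continuous fun H => τ (e H)) {G : C(X, ℂ)} (hinj : Function.Injective G)
    (hG : τ (e G) = G) : τ = e.symm := by
  let φ : C(X, ℂ) →⋆ₐ[ℂ] C(X, ℂ) := (e.trans τ : C(X, ℂ) ≃⋆ₐ[ℂ] C(X, ℂ))
  have hle : StarAlgebra.adjoin ℂ {G} ≤ StarAlgHom.equalizer φ (StarAlgHom.id ℂ _) :=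
    StarAlgHom.adjoin_le_equalizer _ _ fun H hH => by
      rw [mem_singleton_iff.1 hH]
      exact hG
  have htop := StarSubalgebra.topologicalClosure_minimal hle (isClosed_eq hτ continuous_id)
  rw [topologicalClosure_adjoin_singleton_eq_top hinj] at htop
  refine DFunLike.ext _ _ fun T => ?_
  obtain ⟨H, rfl⟩ := e.surjective T
  exact (htop (StarSubalgebra.mem_top (x := H))).trans (e.symm_apply_apply H).symm

/-- The prescribed value at a single symbol with injective `γ_{a,k}` already determines `τ`; the
isometry assumption enters only through continuity. -/
theorem eq_diagonalEquiv_symm (k : ℕ)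
    (τ : toeplitzAlgebra k symbolsWithLimits ≃⋆ₐ[ℂ] C(ℝ≥0∞, ℂ)) (hτ : Isometry τ)
    (h : ∀ (a : Lp ℂ ∞ halfLine) (ha : a ∈ symbolsWithLimits) (ξ : ℝ), 0 < ξ →
      τ ⟨toeplitz k a, toeplitz_mem k ha⟩ (ENNReal.ofReal ξ) = gamma k a ξ) :
    τ = (diagonalEquiv k).symm := by
  obtain ⟨a, ha, G, hG, hinj⟩ := exists_injective_gamma k
  have hτT : τ ⟨toeplitz k a, toeplitz_mem k ha⟩ = G :=
    ext_of_ofReal fun ξ hξ => (h a ha ξ hξ).trans (hG ξ hξ).symm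
  have hτG : τ (diagonalEquiv k G) = G :=
    (congrArg τ (toeplitz_eq_diagonalEquiv k ha hG)).symm.trans hτT
  exact eq_symm_of_apply_injective (diagonalEquiv k) τ
    (hτ.continuous.comp (isometry_diagonalEquiv k).continuous) hinj hτG

end CalderonToeplitz

end

theorem mainTheorem3 (k : ℕ) :
    ∃! τ : CalderonToeplitz.toeplitzAlgebra k CalderonToeplitz.symbolsWithLimits ≃⋆ₐ[ℂ]
        C(ℝ≥0∞, ℂ),
      Isometry τ ∧
        ∀ (a : Lp ℂ ∞ CalderonToeplitz.halfLine) (ha : a ∈ CalderonToeplitz.symbolsWithLimits)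
          (ξ : ℝ), 0 < ξ →
            τ ⟨CalderonToeplitz.toeplitz k a, CalderonToeplitz.toeplitz_mem k ha⟩
              (ENNReal.ofReal ξ) = CalderonToeplitz.gamma k a ξ := by
  refine ⟨(CalderonToeplitz.diagonalEquiv k).symm, ⟨?_, ?_⟩, ?_⟩
  · exact (CalderonToeplitz.isometry_diagonalEquiv k).right_inv
      (CalderonToeplitz.diagonalEquiv k).apply_symm_apply
  · rintro a ⟨g, a₀, aInf, h, h0, hInf⟩ ξ hξ
    obtain ⟨G, -, -, hG⟩ := CalderonToeplitz.exists_continuousMap_gamma k h h0 hInf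
    have hT := (congrArg (CalderonToeplitz.diagonalEquiv k).symm
      (CalderonToeplitz.toeplitz_eq_diagonalEquiv k ⟨g, a₀, aInf, h, h0, hInf⟩ hG)).trans
      ((CalderonToeplitz.diagonalEquiv k).symm_apply_apply G)
    exact (DFunLike.congr_fun hT _).trans (hG ξ hξ)
  · rintro τ ⟨hτ, h⟩
    exact CalderonToeplitz.eq_diagonalEquiv_symm k τ hτ h
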